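/- **Setting.** Let $\Gamma\subset SU(2)$ be a finite subgroup acting on $\mathbb C^2$ on the right by $(z_1,z_2)\mapsto (z_1,z_2)\gamma$, hence on $S^3\subset\mathbb C^2$ and on $S^2=\mathbb{CP}^1$. Let $R$ be the regular representation of $\Gamma$, written $\gamma\mapsto R(\gamma)$, with a $\Gamma$-invariant hermitian metric, and let $V=\mathrm{End}(R)$ with the metric $\mathrm{Tr}(ab^*)$. Let $F$ be the group of unitary transformations of $R$ commuting with $\Gamma$, $T\subset F$ its scalar subgroup, $F^c$ the group of all invertible complex linear transformations of $R$ commuting with $\Gamma$; $F/T\subset F^c/\mathbb C^*$ act on $V$ by conjugation, and the Lie algebra $\mathfrak f/\mathfrak t$ of $F/T$ is identified with the traceless elements of $\mathfrak f=\mathrm{Lie}(F)$, acting on $V$ by $\mathrm{ad}$. Let $Z$ be the center of $\mathfrak f/\mathfrak t$. Sections $\Theta\in C^\infty(E(\Gamma))$ are the smooth maps $\lambda:S^3\to V$ with $\lambda(e^{-i\theta}p)=e^{-i\theta}\lambda(p)$ and $\lambda(p\gamma)=R(\gamma^{-1})\lambda(p)R(\gamma)$, i.e. the $\Gamma$-invariant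 smooth sections of $H\otimes V$ over $\mathbb{CP}^1$, where $H$ is the hyperplane bundle. Let $A_0$ be the connection induced by the Chern connection of $H$, and let $\omega_{vol}$ be the Fubini–Study form on $\mathbb{CP}^1$, with any positive normalization. Let $$\mathcal G^{F,\Gamma}=\mathrm{Map}(S^2/\Gamma,F/T)\subset \mathcal G^{F,\Gamma}_{\mathbb C}=\mathrm{Map}(S^2/\Gamma,F^c/\mathbb C^*)$$ be the groups of smooth $\Gamma$-invariant maps from $S^2$ to $F/T$ and to $F^c/\mathbb C^*$, and let $$\mathcal A^F=\{A_0+B\mid B=\kappa^*\partial\kappa^{*-1}+\kappa^{-1}\bar\partial\kappa,\ \kappa\in\mathcal G^{F,\Gamma}_{\mathbb C}\}.$$ For $\tilde\zeta_1\in Z$ and $(B,\Theta)\in\mathcal A^F\times C^\infty(E(\Gamma))$ (writing $B$ for $A_0+B$) consider the equations $$\bar\partial_{A_0+B}\Theta=0,\tag{1}$$ $$F_B-\tfrac i2[\Theta,\Theta^*]\,\omega_{vol}=\tilde\zeta_1\,\omega_{vol}\quad\text{in }\Omega^2(S^2/\Gamma;\mathfrak f/\mathfrak t),\tag{2}$$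 where $F_B=dB+B\wedge B$ and, in (2), $[\Theta,\Theta^*]$ stands for its pointwise orthogonal projection to $\mathfrak f\otimes\mathbb C$, which is $\frac1{|\Gamma|}\sum_{\gamma}R(\gamma)[\Theta,\Theta^*]R(\gamma)^{-1}$. **Lemma (Uniqueness theorem 1).** Let $\tilde\zeta_1\in Z$ and let $(B_1,\Theta_1)$, $(B_2,\Theta_2)$ in $\mathcal A^F\times C^\infty(E(\Gamma))$ be two solutions of (1) and (2) that lie on the same complex orbit, that is, there is $\kappa\in\mathcal G^{F,\Gamma}_{\mathbb C}$ with $$B_2=\kappa^*\bigl(\partial\kappa^{*-1}+B_1^{1,0}\kappa^{*-1}\bigr)+\kappa^{-1}\bigl(\bar\partial\kappa+B_1^{0,1}\kappa\bigr),\qquad \Theta_2=\kappa^{-1}\Theta_1\kappa .$$ Then they are unitarily gauge equivalent: there is $\rho\in\mathcal G^{F,\Gamma}$ with $$B_2=B_1+\rho\, d_{B_1}\rho^{-1},\qquad \Theta_2=\rho\,\Theta_1\rho^{-1},$$ where $d_{B_1}\rho^{-1}=d\rho^{-1}+[B_1,\rho^{-1}]$. -/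

import Mathlib

set_option maxSynthPendingDepth 3

open scoped ContDiff LinearAlgebra.Projectivization

noncomputable section

namespace ALEGauge

/-! ## The base `S² = ℂP¹`, the Hopf bundle `S³ → S²`, and the right action of `SU(2)`

`ℂ²` is `EuclideanSpace ℂ (Fin 2)`, `S³` is its unit sphere, `S²` is the projective line `ℙ ℂ ℂ²`,
and the Hopf map is `p ↦ [p]`.  Objects on `S²` are differentiated and compared after pulling them
back along the holomorphic submersion `ℂ² ∖ {0} → ℂP¹`, `z ↦ [z]`: functions and differential forms
on `ℂP¹` are determined by their pullbacks, the pullback commutes with `d`, `∂`, `∂̄`, `∧`, and a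
function on `ℂP¹` is smooth exactly when its pullback is. -/

/-- `ℂ²` with its standard hermitian metric. -/
abbrev C2 : Type := EuclideanSpace ℂ (Fin 2)

/-- The total space `S³ ⊂ ℂ²` of the Hopf bundle. -/
abbrev S3 : Type := Metric.sphere (0 : C2) 1

/-- The base `S² = ℂP¹`. -/
abbrev CP1 : Type := ℙ ℂ C2

/-- `SU(2)`. -/
abbrev SU2 : Type := Matrix.specialUnitaryGroup (Fin 2) ℂ

/-- The right action of `SU(2)` on `ℂ²`: the row vector `z` is multiplied by the matrix `γ`. -/
def rightMul (z : C2) (γ : SU2) : C2 :=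
  WithLp.toLp 2 (Matrix.vecMul (WithLp.ofLp z) (γ : Matrix (Fin 2) (Fin 2) ℂ))

theorem rightMul_ne_zero {z : C2} (hz : z ≠ 0) (γ : SU2) : rightMul z γ ≠ 0 := by
  intro h
  apply hz
  have h1 : Matrix.vecMul (WithLp.ofLp z) (γ : Matrix (Fin 2) (Fin 2) ℂ) = 0 := by
    have := congrArg WithLp.ofLp h
    simpa [rightMul] using this
  have h2 : (γ : Matrix (Fin 2) (Fin 2) ℂ) * ((γ⁻¹ : SU2) : Matrix (Fin 2) (Fin 2) ℂ) = 1 := by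
    exact congrArg (fun g : SU2 => (g : Matrix (Fin 2) (Fin 2) ℂ)) (mul_inv_cancel γ)
  have h3 : WithLp.ofLp z = 0 := by
    rw [← Matrix.vecMul_one (WithLp.ofLp z), ← h2, ← Matrix.vecMul_vecMul, h1,
      Matrix.zero_vecMul]
  ext i
  simp [h3]

/-- The point `z / ‖z‖` of `S³`. -/
def toS3 (z : C2) (hz : z ≠ 0) : S3 :=
  ⟨((‖z‖⁻¹ : ℝ) : ℂ) • z, by
    have : ‖z‖ ≠ 0 := norm_ne_zero_iff.mpr hz
    simp [norm_smul, this]⟩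

/-- The pullback to `ℂ² ∖ {0}` of a function on `ℂP¹` (with the irrelevant value `0` at `0`). -/
def pullback {W : Type*} [Zero W] (f : CP1 → W) (z : C2) : W := by
  classical exact if hz : z = 0 then 0 else f (Projectivization.mk ℂ z hz)

/-- The extension `z ↦ ‖z‖ l(z / ‖z‖)` of a function on `S³`, homogeneous of degree one over the
positive reals, to `ℂ² ∖ {0}` (with value `0` at `0`). -/
def homExt {W : Type*} [AddCommGroup W] [Module ℂ W] (l : S3 → W) (z : C2) : W := by
  classical exact if hz : z = 0 then 0 else (‖z‖ : ℂ) • l (toS3 z hz)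

/-- `∂f` at `z` in the direction `v`: the complex linear part of the real differential. -/
def del {W : Type*} [NormedAddCommGroup W] [NormedSpace ℂ W] (f : C2 → W) (z v : C2) : W :=
  (2⁻¹ : ℂ) • (fderiv ℝ f z v - Complex.I • fderiv ℝ f z (Complex.I • v))

/-- `∂̄f` at `z` in the direction `v`: the complex antilinear part of the real differential. -/
def delbar {W : Type*} [NormedAddCommGroup W] [NormedSpace ℂ W] (f : C2 → W) (z v : C2) : W :=
  (2⁻¹ : ℂ) • (fderiv ℝ f z v + Complex.I • fderiv ℝ f z (Complex.I • v))

/-- The pullback to `ℂ² ∖ {0}` of the Fubini–Study form, `(i/2) ∂∂̄ log ‖z‖²`.  It is positive with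
respect to the complex orientation; in the chart `t ↦ [1 : t]` it is
`(1 + |t|²)⁻² d(Re t) ∧ d(Im t)`. -/
def fubiniStudy (z v w : C2) : ℝ :=
  ((inner ℂ v w * (‖z‖ : ℂ) ^ 2 - inner ℂ v z * inner ℂ z w) / (‖z‖ : ℂ) ^ 4).im

/-! ## The groups `F`, `F^c`, `F^c / ℂ^*` and the Lie algebra data

`R` is a complex vector space with a hermitian metric, `V = End(R)`, and `ϱ` is a unitary
representation of a finite subgroup `Γ` of `SU(2)` on `R`. -/

section Groups

variable {Γ : Subgroup SU2} {R : Type*} [NormedAddCommGroup R] [InnerProductSpace ℂ R]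
  [CompleteSpace R]

/-- `ϱ` is (isomorphic to) the regular representation: some basis of `R` indexed by `Γ` is permuted
by left translations. -/
def IsRegular (ϱ : Γ →* unitary (R →L[ℂ] R)) : Prop :=
  ∃ b : Module.Basis Γ ℂ R, ∀ γ g : Γ, (ϱ γ : R →L[ℂ] R) (b g) = b (γ * g)

/-- `F^c`: the invertible linear transformations of `R` that commute with `Γ`. -/
def Fc (ϱ : Γ →* unitary (R →L[ℂ] R)) : Subgroup (R →L[ℂ] R)ˣ where
  carrier := {f | ∀ γ : Γ, (f : R →L[ℂ] R) * (ϱ γ : R →L[ℂ] R) = (ϱ γ : R →L[ℂ] R) * f}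
  one_mem' := fun γ => by simp
  mul_mem' := fun {f g} hf hg γ => by
    rw [Units.val_mul, mul_assoc, hg γ, ← mul_assoc, hf γ, mul_assoc]
  inv_mem' := fun {f} hf γ => by
    have h : Commute (f : R →L[ℂ] R) (ϱ γ : R →L[ℂ] R) := hf γ
    exact h.units_inv_left

/-- The group `ℂ^*` of scalars inside `GL(R)`. -/
def scalarsGL (R : Type*) [NormedAddCommGroup R] [InnerProductSpace ℂ R] :
    Subgroup (R →L[ℂ] R)ˣ :=
  (Units.map (algebraMap ℂ (R →L[ℂ] R)).toMonoidHom).range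

instance scalarsGL_normal : (scalarsGL R).Normal where
  conj_mem := by
    rintro _ ⟨c, rfl⟩ g
    refine ⟨c, ?_⟩
    ext1
    simp only [Units.coe_map, Units.val_mul, RingHom.toMonoidHom_eq_coe, MonoidHom.coe_coe]
    rw [← Algebra.commutes (c : ℂ) (g : R →L[ℂ] R), mul_assoc, Units.mul_inv, mul_one]

/-- The scalar subgroup `ℂ^*` of `F^c`. -/
abbrev Cstar (ϱ : Γ →* unitary (R →L[ℂ] R)) : Subgroup (Fc ϱ) := (scalarsGL R).subgroupOf (Fc ϱ)

/-- `F^c / ℂ^*`. -/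
abbrev PFc (ϱ : Γ →* unitary (R →L[ℂ] R)) : Type _ := Fc ϱ ⧸ Cstar ϱ

/-- The subgroup `F / T` of `F^c / ℂ^*`: the classes of the unitary elements of `F^c`.  (A scalar is
in `F` exactly when it is in `T`, so this is the quotient of `F` by its scalar subgroup `T`.) -/
def PF (ϱ : Γ →* unitary (R →L[ℂ] R)) : Subgroup (PFc ϱ) :=
  Subgroup.map (QuotientGroup.mk' (Cstar ϱ))
    { carrier := {f : Fc ϱ | ((f : (R →L[ℂ] R)ˣ) : R →L[ℂ] R) ∈ unitary (R →L[ℂ] R)}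
      one_mem' := by simp
      mul_mem' := fun {f g} hf hg => by
        exact (unitary (R →L[ℂ] R)).mul_mem hf hg
      inv_mem' := fun {f} hf => by
        have h1 : star ((f : (R →L[ℂ] R)ˣ) : R →L[ℂ] R)
            = (((f : (R →L[ℂ] R)ˣ)⁻¹ : (R →L[ℂ] R)ˣ) : R →L[ℂ] R) :=
          Units.eq_inv_of_mul_eq_one_left (Unitary.mul_star_self_of_mem hf)
        have h2 := Unitary.star_mem hf
        rw [h1] at h2
        simpa using h2 }

/-- The conjugation action of `GL(R)` on `V = End(R)`. -/
def conjGL (R : Type*) [NormedAddCommGroup R] [InnerProductSpace ℂ R] :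
    (R →L[ℂ] R)ˣ →* ((R →L[ℂ] R) →L[ℂ] (R →L[ℂ] R)) where
  toFun f := ContinuousLinearMap.mulLeftRight ℂ (R →L[ℂ] R) (f : R →L[ℂ] R)
    ((f⁻¹ : (R →L[ℂ] R)ˣ) : R →L[ℂ] R)
  map_one' := by
    ext1 X
    simp
  map_mul' f g := by
    ext1 X
    simp [mul_assoc]

theorem conjGL_scalar (R : Type*) [NormedAddCommGroup R] [InnerProductSpace ℂ R] (c : ℂˣ) :
    conjGL R (Units.map (algebraMap ℂ (R →L[ℂ] R)).toMonoidHom c) = 1 := by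
  ext1 X
  simp only [conjGL, MonoidHom.coe_mk, OneHom.coe_mk, ContinuousLinearMap.mulLeftRight_apply,
    one_apply_eq_self]
  have h : Commute (((Units.map (algebraMap ℂ (R →L[ℂ] R)).toMonoidHom c : (R →L[ℂ] R)ˣ) :
      R →L[ℂ] R)) X := Algebra.commutes (c : ℂ) X
  rw [h.eq, mul_assoc, Units.mul_inv, mul_one]

/-- The action of `F^c / ℂ^*` on `V = End(R)` by conjugation, through which `F^c / ℂ^*` is a
(closed) subgroup of `GL(V)`. -/
def Ad (ϱ : Γ →* unitary (R →L[ℂ] R)) :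
    PFc ϱ →* ((R →L[ℂ] R) →L[ℂ] (R →L[ℂ] R)) :=
  QuotientGroup.lift (Cstar ϱ) ((conjGL R).comp (Fc ϱ).subtype) (by
    rintro f ⟨c, hc⟩
    have hc' : (f : (R →L[ℂ] R)ˣ) = Units.map (algebraMap ℂ (R →L[ℂ] R)).toMonoidHom c := hc.symm
    change conjGL R (f : (R →L[ℂ] R)ˣ) = 1
    rw [hc']
    exact conjGL_scalar R c)

theorem star_comm (ϱ : Γ →* unitary (R →L[ℂ] R)) (f : Fc ϱ) (γ : Γ) :
    star ((f : (R →L[ℂ] R)ˣ) : R →L[ℂ] R) * (ϱ γ : R →L[ℂ] R)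
      = (ϱ γ : R →L[ℂ] R) * star ((f : (R →L[ℂ] R)ˣ) : R →L[ℂ] R) := by
  have h := congrArg star (f.2 γ⁻¹)
  have h2 : star ((ϱ γ⁻¹ : unitary (R →L[ℂ] R)) : R →L[ℂ] R) = (ϱ γ : R →L[ℂ] R) := by
    rw [map_inv, ← Unitary.star_eq_inv]
    simp
  rw [star_mul, star_mul, h2] at h
  exact h.symm

/-- `f ↦ (f^*)⁻¹` on `F^c`. -/
def starInvFc (ϱ : Γ →* unitary (R →L[ℂ] R)) : Fc ϱ →* Fc ϱ where
  toFun f := (⟨star (f : (R →L[ℂ] R)ˣ), fun γ => by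
    simpa using star_comm ϱ f γ⟩ : Fc ϱ)⁻¹
  map_one' := by
    ext1
    simp
  map_mul' f g := by
    ext1
    simp

/-- `κ ↦ κ^{*-1}` on `F^c / ℂ^*`; here `κ^*` is the class of the adjoint of a representative of `κ`
for the metric of `R`, and `Ad κ^*` is the adjoint of `Ad κ` for the metric `Tr(a b^*)` of `V`. -/
def starInv (ϱ : Γ →* unitary (R →L[ℂ] R)) : PFc ϱ →* PFc ϱ :=
  QuotientGroup.map (Cstar ϱ) (Cstar ϱ) (starInvFc ϱ) (by
    rintro f ⟨c, hc⟩
    refine ⟨(star c)⁻¹, ?_⟩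
    have hc' : (f : (R →L[ℂ] R)ˣ) = Units.map (algebraMap ℂ (R →L[ℂ] R)).toMonoidHom c := hc.symm
    simp only [starInvFc, MonoidHom.coe_mk, OneHom.coe_mk, Subgroup.subtype_apply,
      map_inv, inv_inj, hc']
    ext1
    simp [Algebra.algebraMap_eq_smul_one])

/-- The centre `Z` of the Lie algebra of `F/T`, that is of the traceless elements of
`𝔣 = {Y ∈ 𝔲(R) | Y commutes with Γ}`. -/
def centre (ϱ : Γ →* unitary (R →L[ℂ] R)) : Set (R →L[ℂ] R) :=
  let f₀ : Set (R →L[ℂ] R) := {Y | star Y = -Y ∧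
    (∀ γ : Γ, Y * (ϱ γ : R →L[ℂ] R) = (ϱ γ : R →L[ℂ] R) * Y) ∧
    LinearMap.trace ℂ R (Y : R →ₗ[ℂ] R) = 0}
  {ζ | ζ ∈ f₀ ∧ ∀ Y ∈ f₀, ζ * Y = Y * ζ}

/-- The adjoint action `X ↦ [a, X]` of `End(R)` on `V = End(R)`. -/
def ad (a : R →L[ℂ] R) : (R →L[ℂ] R) →L[ℂ] (R →L[ℂ] R) :=
  ContinuousLinearMap.mul ℂ (R →L[ℂ] R) a - (ContinuousLinearMap.mul ℂ (R →L[ℂ] R)).flip a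

/-- The average of `X` over `Γ`: the orthogonal projection, for `Tr(a b^*)`, of `End(R)` onto the
commutant `𝔣 ⊗ ℂ` of `Γ`. -/
def average [Fintype Γ] (ϱ : Γ →* unitary (R →L[ℂ] R)) (X : R →L[ℂ] R) : R →L[ℂ] R :=
  (Fintype.card Γ : ℂ)⁻¹ •
    ∑ γ : Γ, (ϱ γ : R →L[ℂ] R) * X * (ϱ γ⁻¹ : unitary (R →L[ℂ] R))

/-! ## Sections, gauge transformations, connections -/

/-- A smooth orbifold section `Θ` of `E(Γ) → S²/Γ`, that is a smooth `Γ`-invariant section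
`[p] ↦ [p, l p]` of `E(End R) = S³ × End(R) / ([p, v] ∼ [p g, g⁻¹ v])`, as an `S¹`- and
`Γ`-equivariant map `l : S³ → End(R)`.  Here `g = e^{iθ}` acts on `S³` by `p g = e^{-iθ} p`, and
`γ⁻¹ v = ϱ(γ⁻¹) v ϱ(γ)`. -/
structure EquivSection (ϱ : Γ →* unitary (R →L[ℂ] R)) where
  toFun : S3 → (R →L[ℂ] R)
  circle_equivariant : ∀ (g : Circle) (p q : S3), (q : C2) = (g : ℂ)⁻¹ • (p : C2) →
    toFun q = (g : ℂ)⁻¹ • toFun p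
  group_equivariant : ∀ (γ : Γ) (p q : S3), (q : C2) = rightMul p (γ : SU2) →
    toFun q = (ϱ γ⁻¹ : unitary (R →L[ℂ] R)) * toFun p * (ϱ γ : R →L[ℂ] R)
  smooth : ContDiffOn ℝ ∞ (homExt toFun) {0}ᶜ

/-- The complex gauge group `Map(S²/Γ, F^c / ℂ^*)`: smooth `Γ`-invariant maps from `S²` to
`F^c / ℂ^*`.  The manifold structure of `F^c / ℂ^*` is that of a submanifold of `GL(V)`. -/
structure ComplexGauge (ϱ : Γ →* unitary (R →L[ℂ] R)) where
  toFun : CP1 → PFc ϱ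
  invariant : ∀ (γ : Γ) (z : C2) (hz : z ≠ 0),
    toFun (Projectivization.mk ℂ (rightMul z (γ : SU2)) (rightMul_ne_zero hz (γ : SU2)))
      = toFun (Projectivization.mk ℂ z hz)
  smooth : ContDiffOn ℝ ∞ (pullback fun x => Ad ϱ (toFun x)) {0}ᶜ

/-- The unitary gauge group `Map(S²/Γ, F/T)`, inside the complex gauge group. -/
def ComplexGauge.IsUnitary {ϱ : Γ →* unitary (R →L[ℂ] R)} (κ : ComplexGauge ϱ) : Prop :=
  ∀ x : CP1, κ.toFun x ∈ PF ϱ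

/-- One-forms `B` on `S²` with values in `End(V)`, pulled back to `ℂ² ∖ {0}`: `B z v` is the value
at `z` on the tangent vector `v`.  (Values at `z = 0` are irrelevant.)  The Lie algebra of
`F^c / ℂ^*` is a subspace of `End(V)` through its action `ad` on `V`. -/
abbrev OneForm (R : Type*) [NormedAddCommGroup R] [InnerProductSpace ℂ R] : Type _ :=
  C2 → C2 → ((R →L[ℂ] R) →L[ℂ] (R →L[ℂ] R))

/-- The `(1,0)`-part of a one-form. -/
def OneForm.part10 (B : OneForm R) : OneForm R := fun z v =>
  (2⁻¹ : ℂ) • (B z v - Complex.I • B z (Complex.I • v))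

/-- The `(0,1)`-part of a one-form. -/
def OneForm.part01 (B : OneForm R) : OneForm R := fun z v =>
  (2⁻¹ : ℂ) • (B z v + Complex.I • B z (Complex.I • v))

/-- The curvature `F_B = dB + B ∧ B`. -/
def curvature (B : OneForm R) (z v w : C2) : (R →L[ℂ] R) →L[ℂ] (R →L[ℂ] R) :=
  fderiv ℝ (fun y => B y w) z v - fderiv ℝ (fun y => B y v) z w + (B z v * B z w - B z w * B z v)

/-- The connection form obtained from `B` by the complex gauge transformation `κ`, i.e. the form of
`κ^* ∘ ∂_{A₀+B} ∘ κ^{*-1} + κ⁻¹ ∘ ∂̄_{A₀+B} ∘ κ`: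
`κ^* (∂κ^{*-1} + B^{1,0} κ^{*-1}) + κ⁻¹ (∂̄κ + B^{0,1} κ)`.
(The base connection `A₀` acts by scalars on `V` and commutes with `κ`.) -/
def ComplexGauge.actForm {ϱ : Γ →* unitary (R →L[ℂ] R)} (κ : ComplexGauge ϱ) (B : OneForm R) :
    OneForm R := fun z v =>
  pullback (fun x => Ad ϱ (starInv ϱ (κ.toFun x))⁻¹) z
      * (del (pullback fun x => Ad ϱ (starInv ϱ (κ.toFun x))) z v
        + B.part10 z v * pullback (fun x => Ad ϱ (starInv ϱ (κ.toFun x))) z)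
    + pullback (fun x => Ad ϱ (κ.toFun x)⁻¹) z
      * (delbar (pullback fun x => Ad ϱ (κ.toFun x)) z v
        + B.part01 z v * pullback (fun x => Ad ϱ (κ.toFun x)) z)

/-- The configuration space `𝒜^F × C^∞(E(Γ))`.  A connection `A₀ + B` in `𝒜^F` is given by
`B = κ^* ∂κ^{*-1} + κ⁻¹ ∂̄κ` for a complex gauge transformation `κ`; here `A₀` is the connection
induced on `E(Γ)` by the Chern connection of the hyperplane bundle `S³ ×_{S¹} ℂ`. -/
structure Configuration (ϱ : Γ →* unitary (R →L[ℂ] R)) where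
  B : OneForm R
  mem : ∃ κ : ComplexGauge ϱ, ∀ z : C2, z ≠ 0 → ∀ v : C2, B z v = κ.actForm 0 z v
  Θ : EquivSection ϱ

/-- The holomorphicity equation `∂̄_{A₀+B} Θ = 0`.  Smooth sections of the hyperplane bundle
(tensor `V`) are the smooth functions on `ℂ² ∖ {0}` that are homogeneous of degree one over `ℂ^*`,
and `∂̄_{A₀}` is the ordinary `∂̄` of these functions; the homogeneous function that belongs to an
equivariant map on `S³` is `homExt`. -/
def Configuration.Holomorphic {ϱ : Γ →* unitary (R →L[ℂ] R)} (x : Configuration ϱ) : Prop :=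
  ∀ z : C2, z ≠ 0 → ∀ v : C2,
    delbar (homExt x.Θ.toFun) z v + x.B.part01 z v (homExt x.Θ.toFun z) = 0

/-- The first moment map equation `F_B - (i/2) [Θ, Θ^*] ω_vol = ζ ω_vol`, an equation between
two-forms on `S²/Γ` with values in the Lie algebra of `F/T` (which acts on `V` by `ad`), with
`ω_vol = c · fubiniStudy`.  As a term of this equation `[Θ, Θ^*]` is the element of
`Ω⁰(S²/Γ; 𝔣 ⊗ ℂ)` that it defines by the trace pairing, i.e. its pointwise orthogonal projection. -/
def Configuration.MomentMap [Fintype Γ] {ϱ : Γ →* unitary (R →L[ℂ] R)} (c : ℝ)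
    (ζ : R →L[ℂ] R) (x : Configuration ϱ) : Prop :=
  ∀ (z : C2) (hz : z ≠ 0) (v w : C2),
    curvature x.B z v w
      - (Complex.I / 2 * ((c * fubiniStudy z v w : ℝ) : ℂ)) •
          ad (average ϱ (x.Θ.toFun (toS3 z hz) * star (x.Θ.toFun (toS3 z hz))
            - star (x.Θ.toFun (toS3 z hz)) * x.Θ.toFun (toS3 z hz)))
      = ((c * fubiniStudy z v w : ℝ) : ℂ) • ad ζ

/-- `x₁` and `x₂` lie on the same complex orbit through `κ`: `B₂` is the transform of `B₁` by `κ`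
(so that `∂̄_{B₁} κ = κ ∂̄_{B₂}`) and `Θ₁ κ = κ Θ₂`, i.e. `Θ₁ = κ Θ₂ κ⁻¹`. -/
def ComplexRelated {ϱ : Γ →* unitary (R →L[ℂ] R)} (κ : ComplexGauge ϱ)
    (x₁ x₂ : Configuration ϱ) : Prop :=
  (∀ z : C2, z ≠ 0 → ∀ v : C2, x₂.B z v = κ.actForm x₁.B z v) ∧
  ∀ (z : C2) (hz : z ≠ 0), x₁.Θ.toFun (toS3 z hz)
    = Ad ϱ (κ.toFun (Projectivization.mk ℂ z hz)) (x₂.Θ.toFun (toS3 z hz))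

/-- `x₂ = ρ · x₁ = (B₁ + ρ d_{B₁} ρ⁻¹, ρ Θ₁ ρ⁻¹)`, where
`d_{B₁} ρ⁻¹ = dρ⁻¹ + B₁ ρ⁻¹ - ρ⁻¹ B₁`. -/
def UnitaryRelated {ϱ : Γ →* unitary (R →L[ℂ] R)} (ρ : ComplexGauge ϱ)
    (x₁ x₂ : Configuration ϱ) : Prop :=
  ρ.IsUnitary ∧
  (∀ z : C2, z ≠ 0 → ∀ v : C2, x₂.B z v = x₁.B z v
    + pullback (fun x => Ad ϱ (ρ.toFun x)) z
      * (fderiv ℝ (pullback fun x => Ad ϱ (ρ.toFun x)⁻¹) z v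
        + x₁.B z v * pullback (fun x => Ad ϱ (ρ.toFun x)⁻¹) z
        - pullback (fun x => Ad ϱ (ρ.toFun x)⁻¹) z * x₁.B z v)) ∧
  ∀ (z : C2) (hz : z ≠ 0), x₂.Θ.toFun (toS3 z hz)
    = Ad ϱ (ρ.toFun (Projectivization.mk ℂ z hz)) (x₁.Θ.toFun (toS3 z hz))

end Groups

end ALEGauge

end

open ALEGauge

noncomputable section

namespace ALEGauge

/-! ## Bounded subharmonic functions on the punctured plane -/

/-! Represent the gauge transformation `κ` by the matrix `K` of `Ad κ` on `End(R)`, and study `u =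
tr (K K^*)` on `ℂ² ∖ {0}`. Since `B₂` is the transform of `B₁` by `κ`, half of the covariant
derivatives vanish: `∂̄K = 0` and `∂K^* = 0` covariantly. Computing `∂∂̄u` therefore leaves only the
square of the other half `Y = ∂̄_B K^*` and a difference of curvatures (`del_delbar_trace`). By the
moment map equations this difference is a positive multiple of the Fubini–Study form times a sum of
squares `N`, which measures the failure of `κ^*` to intertwine `Θ₁` and `Θ₂`; the central term `ζ`
cancels (`exists_moment_variation`). Hence `u` is subharmonic on every complex line.

As `u` comes from the compact `ℂP¹`, it is bounded. A bounded subharmonic function on a complex line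
missing the origin has zero Laplacian (`lineLaplacian_eq_zero_of_bounded`), so `Y = 0` and `N = 0`:
`κ` is covariantly constant and `κ^* Θ₁ = Θ₂ κ^*` (`rigidity`).

It remains to take the polar decomposition. The endomorphism `H = K K^*` is parallel for `B₁`, so
one polynomial annihilates it at all points, and its positive square root is a fixed polynomial in
`H`; this makes the positive part `P` of `κ` smooth and parallel
(`exists_polynomial_positive_part`). Moreover `κ κ^*`, hence `P`, commutes with `Θ₁`. So `P` fixes
the first solution, and `ρ = κ⁻¹ P`, which is unitary, carries it to the second
(`exists_unitaryRelated`). -/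

theorem hasDerivAt_intervalIntegral_of_continuous {F F' : ℝ → ℝ → ℝ} (a b s : ℝ)
    (hF : ∀ s, Continuous (F s)) (hF' : Continuous (Function.uncurry F'))
    (h : ∀ s t, HasDerivAt (fun s => F s t) (F' s t) s) :
    HasDerivAt (fun s => ∫ t in a..b, F s t) (∫ t in a..b, F' s t) s := by
  obtain ⟨C, hC⟩ := ((isCompact_closedBall s 1).prod (isCompact_uIcc (a := a) (b := b))).bddAbove_image
    (f := fun p : ℝ × ℝ => ‖Function.uncurry F' p‖) hF'.norm.continuousOn
  have hF's : Continuous (F' s) := hF'.comp (by fun_prop : Continuous fun t : ℝ => (s, t))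
  refine (intervalIntegral.hasDerivAt_integral_of_dominated_loc_of_deriv_le
    (bound := fun _ => C) (Metric.ball_mem_nhds s one_pos) ?_ ?_ ?_ ?_ ?_ ?_).2
  · exact .of_forall fun x => (hF x).aestronglyMeasurable
  · exact (hF s).intervalIntegrable _ _
  · exact hF's.aestronglyMeasurable
  · refine .of_forall fun t ht x hx => hC ⟨(x, t), ⟨Metric.ball_subset_closedBall hx, ?_⟩, rfl⟩
    exact Set.uIoc_subset_uIcc ht
  · exact intervalIntegrable_const
  · exact .of_forall fun t _ x _ => h x t

/-- A convex function that lies above a tangent line of nonzero slope is unbounded in one direction.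
-/
theorem deriv_eq_zero_of_monotone_of_bounded {f f' : ℝ → ℝ} {C : ℝ}
    (hf : ∀ s, HasDerivAt f (f' s) s) (hmono : Monotone f') (hC : ∀ s, |f s| ≤ C) (s : ℝ) :
    f' s = 0 := by
  have hcont : Continuous f := continuous_iff_continuousAt.2 fun x => (hf x).continuousAt
  have hC0 : 0 ≤ C := (abs_nonneg _).trans (hC 0)
  by_contra hne
  rcases lt_or_gt_of_ne hne with hneg | hpos
  -- With this length the mean value theorem forces `f` to vary by at least `2 * C + 1`, more than
  -- the bound `C` allows.
  · set r := (2 * C + 1) / (-f' s) with hr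
    have hr0 : 0 < r := by apply div_pos <;> linarith
    obtain ⟨x, hx, hxe⟩ := exists_hasDerivAt_eq_slope f f' (by linarith : s - r < s)
      hcont.continuousOn fun x _ => hf x
    have h1 := hmono hx.2.le
    rw [hxe, div_le_iff₀ (by linarith)] at h1
    have h2 : f' s * (s - (s - r)) = -(2 * C + 1) := by
      rw [hr]; field_simp; ring
    have h3 := abs_le.1 (hC s)
    have h4 := abs_le.1 (hC (s - r))
    linarith
  · set r := (2 * C + 1) / f' s with hr
    have hr0 : 0 < r := by apply div_pos <;> linarith
    obtain ⟨x, hx, hxe⟩ := exists_hasDerivAt_eq_slope f f' (by linarith : s < s + r)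
      hcont.continuousOn fun x _ => hf x
    have h1 := hmono hx.1.le
    rw [hxe, le_div_iff₀ (by linarith)] at h1
    have h2 : f' s * (s + r - s) = 2 * C + 1 := by
      rw [hr]; field_simp; ring
    have h3 := abs_le.1 (hC s)
    have h4 := abs_le.1 (hC (s + r))
    linarith

/-- Integrating over a period removes `Utt`, so the mean of `U s` over `t` has second derivative
equal to the integral of the Laplacian. That mean is convex and bounded, hence constant; a
continuous nonnegative Laplacian with zero integral vanishes. -/
theorem laplacian_eq_zero_of_periodic_of_bounded {U Us Uss Ut Utt : ℝ → ℝ → ℝ} {C P : ℝ}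
    (hP : 0 < P)
    (hU : ∀ s, Continuous (U s)) (hUs : Continuous (Function.uncurry Us))
    (hUss : Continuous (Function.uncurry Uss)) (hUtt : Continuous (Function.uncurry Utt))
    (h1 : ∀ s t, HasDerivAt (fun s => U s t) (Us s t) s)
    (h2 : ∀ s t, HasDerivAt (fun s => Us s t) (Uss s t) s)
    (h3 : ∀ s t, HasDerivAt (Ut s) (Utt s t) t)
    (hper : ∀ s, Ut s P = Ut s 0) (hC : ∀ s t, |U s t| ≤ C)
    (hsub : ∀ s t, 0 ≤ Uss s t + Utt s t) (s : ℝ) : Uss s 0 + Utt s 0 = 0 := by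
  have sec : ∀ {G : ℝ → ℝ → ℝ}, Continuous (Function.uncurry G) → ∀ s, Continuous (G s) :=
    fun hG s => hG.comp (by fun_prop : Continuous fun t : ℝ => (s, t))
  have d1 := fun s => hasDerivAt_intervalIntegral_of_continuous 0 P s hU hUs h1
  have d2 := fun s => hasDerivAt_intervalIntegral_of_continuous 0 P s (sec hUs) hUss h2
  have hlap : ∀ s, (∫ t in (0 : ℝ)..P, Uss s t) = ∫ t in (0 : ℝ)..P, (Uss s t + Utt s t) := by
    intro s
    rw [intervalIntegral.integral_add ((sec hUss s).intervalIntegrable _ _)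
      ((sec hUtt s).intervalIntegrable _ _),
      intervalIntegral.integral_eq_sub_of_hasDerivAt (fun t _ => h3 s t)
        ((sec hUtt s).intervalIntegrable _ _), hper, sub_self, add_zero]
  have hnn : ∀ s, 0 ≤ ∫ t in (0 : ℝ)..P, Uss s t := fun s => by
    rw [hlap]
    exact intervalIntegral.integral_nonneg hP.le fun t _ => hsub s t
  have hmono : Monotone fun s => ∫ t in (0 : ℝ)..P, Us s t :=
    monotone_of_hasDerivAt_nonneg d2 hnn
  have hbd : ∀ s, |∫ t in (0 : ℝ)..P, U s t| ≤ C * |P - 0| := fun s => by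
    rw [← Real.norm_eq_abs]
    exact intervalIntegral.norm_integral_le_of_norm_le_const fun t _ => hC s t
  have hz := deriv_eq_zero_of_monotone_of_bounded d1 hmono hbd
  have hz2 : (∫ t in (0 : ℝ)..P, Uss s t) = 0 := by
    have := d2 s
    rw [show (fun s => ∫ t in (0 : ℝ)..P, Us s t) = fun _ => 0 from funext hz] at this
    exact this.unique (hasDerivAt_const _ _)
  rw [hlap] at hz2
  by_contra hne
  have hpos : 0 < Uss s 0 + Utt s 0 := lt_of_le_of_ne (hsub s 0) (Ne.symm hne)
  have := intervalIntegral.integral_pos (f := fun t => Uss s t + Utt s t) hP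
    ((sec hUss s).add (sec hUtt s)).continuousOn (fun t _ => hsub s t) ⟨0, by simp [hP.le], hpos⟩
  linarith

/-- The Laplacian of `u` along the complex line through `z` in the direction `v`. -/
def lineLaplacian {W : Type*} [NormedAddCommGroup W] [NormedSpace ℝ W] (u : C2 → W) (z v : C2) : W :=
  fderiv ℝ (fun y => fderiv ℝ u y v) z v
    + fderiv ℝ (fun y => fderiv ℝ u y (Complex.I • v)) z (Complex.I • v)

theorem contDiffAt_of_punctured {W : Type*} [NormedAddCommGroup W] [NormedSpace ℝ W] {f : C2 → W}
    (hf : ContDiffOn ℝ ∞ f {0}ᶜ) {z : C2} (hz : z ≠ 0) : ContDiffAt ℝ ∞ f z :=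
  hf.contDiffAt (isOpen_compl_singleton.mem_nhds hz)

theorem differentiableAt_of_punctured {W : Type*} [NormedAddCommGroup W] [NormedSpace ℝ W]
    {f : C2 → W} (hf : ContDiffOn ℝ ∞ f {0}ᶜ) {z : C2} (hz : z ≠ 0) : DifferentiableAt ℝ f z :=
  (contDiffAt_of_punctured hf hz).differentiableAt (by simp)

theorem contDiffOn_fderiv_punctured {W : Type*} [NormedAddCommGroup W] [NormedSpace ℝ W]
    {f : C2 → W} (hf : ContDiffOn ℝ ∞ f {0}ᶜ) : ContDiffOn ℝ ∞ (fderiv ℝ f) {0}ᶜ :=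
  hf.fderiv_of_isOpen isOpen_compl_singleton (by simp)

theorem contDiffOn_fderiv_apply_punctured {W : Type*} [NormedAddCommGroup W] [NormedSpace ℝ W]
    {f : C2 → W} (hf : ContDiffOn ℝ ∞ f {0}ᶜ) (v : C2) :
    ContDiffOn ℝ ∞ (fun z => fderiv ℝ f z v) {0}ᶜ :=
  (contDiffOn_fderiv_punctured hf).clm_apply contDiffOn_const

set_option maxHeartbeats 1000000 in
-- Independence keeps the line `z + ℂ v` away from the origin. Logarithmic polar coordinates on it
-- turn circles into periods, so the convexity of circular means applies.
theorem lineLaplacian_eq_zero_of_bounded {u : C2 → ℝ} (hu : ContDiffOn ℝ ∞ u {0}ᶜ) {C : ℝ}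
    (hC : ∀ z, z ≠ 0 → |u z| ≤ C) (hsub : ∀ z, z ≠ 0 → ∀ v, 0 ≤ lineLaplacian u z v)
    {z v : C2} (hzv : LinearIndependent ℂ ![z, v]) : lineLaplacian u z v = 0 := by
  -- The coordinates are centred at `z - v`, so that `w = 0` corresponds to the point `z` itself.
  set γ : ℂ → C2 := fun w => (z - v) + Complex.exp w • v with hγ
  have hγ0 : ∀ w, γ w ≠ 0 := by
    intro w hw
    have := LinearIndependent.pair_iff.1 hzv 1 (Complex.exp w - 1)
      (by rw [← hw, hγ]; module)
    exact one_ne_zero this.1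
  set e : ℝ → ℝ → ℂ := fun s t => (s : ℂ) + t * Complex.I with he
  have hes : ∀ s t, HasDerivAt (fun s => Complex.exp (e s t)) (Complex.exp (e s t)) s := by
    intro s t
    have h1 : HasDerivAt (fun s : ℝ => e s t) 1 s := by
      simpa [he] using (Complex.ofRealCLM.hasDerivAt (x := s)).add_const ((t : ℂ) * Complex.I)
    simpa using h1.cexp
  have het : ∀ s t, HasDerivAt (fun t => Complex.exp (e s t)) (Complex.exp (e s t) * Complex.I) t := by
    intro s t
    have h1 : HasDerivAt (fun t : ℝ => e s t) Complex.I t := by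
      simpa [he] using ((Complex.ofRealCLM.hasDerivAt (x := t)).mul_const Complex.I).const_add (s : ℂ)
    simpa using h1.cexp
  have hγs : ∀ s t, HasDerivAt (fun s => γ (e s t)) (Complex.exp (e s t) • v) s := fun s t =>
    ((hes s t).smul_const v).const_add _
  have hγt : ∀ s t, HasDerivAt (fun t => γ (e s t)) (Complex.exp (e s t) • Complex.I • v) t :=
    fun s t => by
      rw [smul_smul]
      exact ((het s t).smul_const v).const_add (z - v)
  have hγc : Continuous fun p : ℝ × ℝ => γ (e p.1 p.2) := by
    simp only [hγ, he]; fun_prop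
  have hec : Continuous fun p : ℝ × ℝ => Complex.exp (e p.1 p.2) := by
    simp only [he]; fun_prop
  have hfd := contDiffOn_fderiv_punctured hu
  have hfdd := contDiffOn_fderiv_punctured hfd
  have c1 : Continuous fun p : ℝ × ℝ => fderiv ℝ u (γ (e p.1 p.2)) :=
    hfd.continuousOn.comp_continuous hγc fun p => hγ0 _
  have c2 : Continuous fun p : ℝ × ℝ => fderiv ℝ (fderiv ℝ u) (γ (e p.1 p.2)) :=
    hfdd.continuousOn.comp_continuous hγc fun p => hγ0 _
  have du : ∀ s t, HasFDerivAt u (fderiv ℝ u (γ (e s t))) (γ (e s t)) := fun s t =>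
    (differentiableAt_of_punctured hu (hγ0 _)).hasFDerivAt
  have ddu : ∀ s t, HasFDerivAt (fderiv ℝ u) (fderiv ℝ (fderiv ℝ u) (γ (e s t))) (γ (e s t)) :=
    fun s t => (differentiableAt_of_punctured hfd (hγ0 _)).hasFDerivAt
  have key : ∀ x, x ≠ 0 → ∀ a : C2, lineLaplacian u x a = fderiv ℝ (fderiv ℝ u) x a a
      + fderiv ℝ (fderiv ℝ u) x (Complex.I • a) (Complex.I • a) := by
    intro x hx a
    have hd := differentiableAt_of_punctured hfd hx
    have h : ∀ b c : C2, fderiv ℝ (fun y => fderiv ℝ u y b) x c = fderiv ℝ (fderiv ℝ u) x c b := by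
      intro b c
      rw [fderiv_clm_apply hd (differentiableAt_const _)]
      simp
    rw [lineLaplacian, h, h]
  have main := laplacian_eq_zero_of_periodic_of_bounded (P := 2 * Real.pi) (C := C)
    (U := fun s t => u (γ (e s t)))
    (Us := fun s t => fderiv ℝ u (γ (e s t)) (Complex.exp (e s t) • v))
    (Uss := fun s t => fderiv ℝ (fderiv ℝ u) (γ (e s t)) (Complex.exp (e s t) • v)
      (Complex.exp (e s t) • v) + fderiv ℝ u (γ (e s t)) (Complex.exp (e s t) • v))
    (Ut := fun s t => fderiv ℝ u (γ (e s t)) (Complex.exp (e s t) • Complex.I • v))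
    (Utt := fun s t => fderiv ℝ (fderiv ℝ u) (γ (e s t)) (Complex.exp (e s t) • Complex.I • v)
      (Complex.exp (e s t) • Complex.I • v)
      + fderiv ℝ u (γ (e s t)) ((Complex.exp (e s t) * Complex.I) • Complex.I • v))
    (by positivity)
    (fun s => by
      exact hu.continuousOn.comp_continuous
        (hγc.comp (by fun_prop : Continuous fun t : ℝ => (s, t))) fun t => hγ0 _)
    (c1.clm_apply (by fun_prop))
    (((c2.clm_apply (by fun_prop)).clm_apply (by fun_prop)).add (c1.clm_apply (by fun_prop)))
    (((c2.clm_apply (by fun_prop)).clm_apply (by fun_prop)).add (c1.clm_apply (by fun_prop)))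
    (fun s t => (du s t).comp_hasDerivAt s (hγs s t))
    (fun s t => ((ddu s t).comp_hasDerivAt s (hγs s t)).clm_apply ((hes s t).smul_const v))
    (fun s t => ((ddu s t).comp_hasDerivAt t (hγt s t)).clm_apply
      ((het s t).smul_const (Complex.I • v)))
    (fun s => by
      have h : Complex.exp (e s (2 * Real.pi)) = Complex.exp (e s 0) := by
        have := Complex.exp_periodic (e s 0)
        rw [← this]
        congr 1
        simp [he]
      simp only [hγ, h])
    (fun s t => hC _ (hγ0 _))
    (fun s t => by
      have h := hsub _ (hγ0 (e s t)) (Complex.exp (e s t) • v)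
      rw [key _ (hγ0 _), smul_comm Complex.I] at h
      -- The first-order terms coming from the second derivatives of `exp` in `s` and in `t` are
      -- opposite, so only the line Laplacian in the direction `exp w • v` is left.
      have h2 : (Complex.exp (e s t) * Complex.I) • Complex.I • v = -(Complex.exp (e s t) • v) := by
        rw [smul_smul, mul_assoc, Complex.I_mul_I]; module
      rw [h2, map_neg]
      linarith)
    0
  have e0 : Complex.exp (e 0 0) = 1 := by simp [he]
  have g0 : γ (e 0 0) = z := by simp [hγ, e0]
  have hz : z ≠ 0 := g0 ▸ hγ0 _
  have h2 : (1 * Complex.I) • Complex.I • v = -v := by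
    rw [smul_smul, one_mul, Complex.I_mul_I]; module
  simp only [e0, g0, one_smul, h2, map_neg] at main
  rw [key z hz]
  linarith

/-! ## Wirtinger calculus -/

section Wirtinger

variable {W W' : Type*} [NormedAddCommGroup W] [NormedSpace ℂ W]
  [NormedAddCommGroup W'] [NormedSpace ℂ W'] {f g : C2 → W} {z v : C2}

theorem del_add (hf : DifferentiableAt ℝ f z) (hg : DifferentiableAt ℝ g z) :
    del (fun y => f y + g y) z v = del f z v + del g z v := by
  simp only [del, fderiv_fun_add hf hg, add_apply]
  module

theorem del_sub (hf : DifferentiableAt ℝ f z) (hg : DifferentiableAt ℝ g z) :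
    del (fun y => f y - g y) z v = del f z v - del g z v := by
  simp only [del, fderiv_fun_sub hf hg, sub_apply]
  module

theorem delbar_sub (hf : DifferentiableAt ℝ f z) (hg : DifferentiableAt ℝ g z) :
    delbar (fun y => f y - g y) z v = delbar f z v - delbar g z v := by
  simp only [delbar, fderiv_fun_sub hf hg, sub_apply]
  module

theorem del_add_delbar (f : C2 → W) (z v : C2) : del f z v + delbar f z v = fderiv ℝ f z v := by
  simp only [del, delbar]
  module

theorem del_add_right (f : C2 → W) (z v w : C2) : del f z (v + w) = del f z v + del f z w := by
  simp only [del, smul_add, map_add]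
  module

theorem delbar_add_right (f : C2 → W) (z v w : C2) :
    delbar f z (v + w) = delbar f z v + delbar f z w := by
  simp only [delbar, smul_add, map_add]
  module

theorem del_congr (h : ∀ y, y ≠ 0 → f y = g y) (hz : z ≠ 0) : del f z v = del g z v := by
  have : f =ᶠ[nhds z] g := by
    filter_upwards [isOpen_compl_singleton.mem_nhds hz] with y hy using h y hy
  simp only [del, this.fderiv_eq]

theorem delbar_congr (h : ∀ y, y ≠ 0 → f y = g y) (hz : z ≠ 0) :
    delbar f z v = delbar g z v := by
  have : f =ᶠ[nhds z] g := by
    filter_upwards [isOpen_compl_singleton.mem_nhds hz] with y hy using h y hy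
  simp only [delbar, this.fderiv_eq]

theorem fderiv_clm_comp (L : W →L[ℂ] W') (hf : DifferentiableAt ℝ f z) :
    fderiv ℝ (fun y => L (f y)) z v = L (fderiv ℝ f z v) := by
  have := ((L.restrictScalars ℝ).hasFDerivAt.comp z hf.hasFDerivAt).fderiv
  exact congrArg (fun A => A v) this

theorem del_clm_comp (L : W →L[ℂ] W') (hf : DifferentiableAt ℝ f z) :
    del (fun y => L (f y)) z v = L (del f z v) := by
  simp only [del, fderiv_clm_comp L hf, map_smul, map_sub]

theorem delbar_clm_comp (L : W →L[ℂ] W') (hf : DifferentiableAt ℝ f z) :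
    delbar (fun y => L (f y)) z v = L (delbar f z v) := by
  simp only [delbar, fderiv_clm_comp L hf, map_smul, map_add]

theorem contDiffOn_clm_comp (L : W →L[ℂ] W') {s : Set C2} (hf : ContDiffOn ℝ ∞ f s) :
    ContDiffOn ℝ ∞ (fun y => L (f y)) s :=
  (L.restrictScalars ℝ).contDiff.comp_contDiffOn hf

theorem contDiffOn_delbar (hf : ContDiffOn ℝ ∞ f {0}ᶜ) (v : C2) :
    ContDiffOn ℝ ∞ (fun z => delbar f z v) {0}ᶜ :=
  contDiffOn_const.smul ((contDiffOn_fderiv_apply_punctured hf v).add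
    (contDiffOn_const.smul (contDiffOn_fderiv_apply_punctured hf _)))

theorem fderiv_fderiv_apply (hf : ContDiffOn ℝ ∞ f {0}ᶜ) (hz : z ≠ 0) (a b : C2) :
    fderiv ℝ (fun y => fderiv ℝ f y a) z b = fderiv ℝ (fderiv ℝ f) z b a := by
  rw [fderiv_clm_apply (differentiableAt_of_punctured (contDiffOn_fderiv_punctured hf) hz)
    (differentiableAt_const _)]
  simp

theorem fderiv_fderiv_comm (hf : ContDiffOn ℝ ∞ f {0}ᶜ) (hz : z ≠ 0) (a b : C2) :
    fderiv ℝ (fderiv ℝ f) z a b = fderiv ℝ (fderiv ℝ f) z b a :=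
  (contDiffAt_of_punctured hf hz).isSymmSndFDerivAt
    (by rw [minSmoothness_of_isRCLikeNormedField]; exact WithTop.coe_le_coe.2 (le_top : (2 : ℕ∞) ≤ ⊤)) a b

theorem fderiv_delbar (hf : ContDiffOn ℝ ∞ f {0}ᶜ) (hz : z ≠ 0) (a b : C2) :
    fderiv ℝ (fun y => delbar f y a) z b = (2⁻¹ : ℂ) • (fderiv ℝ (fderiv ℝ f) z b a
      + Complex.I • fderiv ℝ (fderiv ℝ f) z b (Complex.I • a)) := by
  have h := fun a => differentiableAt_of_punctured (contDiffOn_fderiv_apply_punctured hf a) hz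
  have h1 : fderiv ℝ (fun y => delbar f y a) z = (2⁻¹ : ℂ) • (fderiv ℝ (fun y => fderiv ℝ f y a) z
      + Complex.I • fderiv ℝ (fun y => fderiv ℝ f y (Complex.I • a)) z) := by
    simp only [delbar]
    exact (((h a).hasFDerivAt.add ((h _).hasFDerivAt.const_smul Complex.I)).const_smul
      (2⁻¹ : ℂ)).fderiv
  rw [h1]
  simp only [smul_apply, add_apply, fderiv_fderiv_apply hf hz]

theorem fderiv_del (hf : ContDiffOn ℝ ∞ f {0}ᶜ) (hz : z ≠ 0) (a b : C2) :
    fderiv ℝ (fun y => del f y a) z b = (2⁻¹ : ℂ) • (fderiv ℝ (fderiv ℝ f) z b a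
      - Complex.I • fderiv ℝ (fderiv ℝ f) z b (Complex.I • a)) := by
  have h := fun a => differentiableAt_of_punctured (contDiffOn_fderiv_apply_punctured hf a) hz
  have h1 : fderiv ℝ (fun y => del f y a) z = (2⁻¹ : ℂ) • (fderiv ℝ (fun y => fderiv ℝ f y a) z
      - Complex.I • fderiv ℝ (fun y => fderiv ℝ f y (Complex.I • a)) z) := by
    simp only [del]
    exact (((h a).hasFDerivAt.sub ((h _).hasFDerivAt.const_smul Complex.I)).const_smul
      (2⁻¹ : ℂ)).fderiv
  rw [h1]
  simp only [smul_apply, sub_apply, fderiv_fderiv_apply hf hz]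

/-- Symmetry of the second derivative cancels the mixed terms. Together with `delbar_del` this also
shows that `∂` and `∂̄` in the same direction commute. -/
theorem del_delbar (hf : ContDiffOn ℝ ∞ f {0}ᶜ) (hz : z ≠ 0) (v : C2) :
    del (fun y => delbar f y v) z v = (4⁻¹ : ℂ) • lineLaplacian f z v := by
  rw [del, fderiv_delbar hf hz, fderiv_delbar hf hz, lineLaplacian, fderiv_fderiv_apply hf hz,
    fderiv_fderiv_apply hf hz, fderiv_fderiv_comm hf hz v (Complex.I • v)]
  simp only [smul_add, smul_sub, smul_smul]
  ring_nf
  simp only [Complex.I_sq]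
  module

theorem delbar_del (hf : ContDiffOn ℝ ∞ f {0}ᶜ) (hz : z ≠ 0) (v : C2) :
    delbar (fun y => del f y v) z v = (4⁻¹ : ℂ) • lineLaplacian f z v := by
  rw [delbar, fderiv_del hf hz, fderiv_del hf hz, lineLaplacian, fderiv_fderiv_apply hf hz,
    fderiv_fderiv_apply hf hz, fderiv_fderiv_comm hf hz v (Complex.I • v)]
  simp only [smul_add, smul_sub, smul_smul]
  ring_nf
  simp only [Complex.I_sq]
  module

theorem lineLaplacian_clm_comp {E E' : Type*} [NormedAddCommGroup E] [NormedSpace ℝ E]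
    [NormedAddCommGroup E'] [NormedSpace ℝ E'] (L : E →L[ℝ] E') {f : C2 → E}
    (hf : ContDiffOn ℝ ∞ f {0}ᶜ) (hz : z ≠ 0) (v : C2) :
    lineLaplacian (fun y => L (f y)) z v = L (lineLaplacian f z v) := by
  have h1 : ∀ a, ∀ y, y ≠ 0 → fderiv ℝ (fun y => L (f y)) y a = L (fderiv ℝ f y a) := by
    intro a y hy
    have := (L.hasFDerivAt.comp y (differentiableAt_of_punctured hf hy).hasFDerivAt).fderiv
    exact congrArg (fun A => A a) this
  have h2 : ∀ a, fderiv ℝ (fun y => fderiv ℝ (fun y => L (f y)) y a) z a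
      = L (fderiv ℝ (fun y => fderiv ℝ f y a) z a) := by
    intro a
    have : (fun y => fderiv ℝ (fun y => L (f y)) y a) =ᶠ[nhds z] fun y => L (fderiv ℝ f y a) := by
      filter_upwards [isOpen_compl_singleton.mem_nhds hz] with y hy using h1 a y hy
    rw [this.fderiv_eq]
    have := (L.hasFDerivAt.comp z
      (differentiableAt_of_punctured (contDiffOn_fderiv_apply_punctured hf a) hz).hasFDerivAt).fderiv
    exact congrArg (fun A => A a) this
  simp only [lineLaplacian, h2, map_add]

variable {M : Type*} [NormedRing M] [NormedAlgebra ℂ M] {A B : C2 → M}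

theorem fderiv_mul_punctured (hA : DifferentiableAt ℝ A z) (hB : DifferentiableAt ℝ B z) :
    fderiv ℝ (fun y => A y * B y) z v = fderiv ℝ A z v * B z + A z * fderiv ℝ B z v := by
  rw [fderiv_fun_mul' hA hB]
  simp [add_comm]

theorem del_mul (hA : DifferentiableAt ℝ A z) (hB : DifferentiableAt ℝ B z) :
    del (fun y => A y * B y) z v = del A z v * B z + A z * del B z v := by
  simp only [del, fderiv_mul_punctured hA hB, smul_mul_assoc, mul_smul_comm, sub_mul, mul_sub]
  module

theorem delbar_mul (hA : DifferentiableAt ℝ A z) (hB : DifferentiableAt ℝ B z) :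
    delbar (fun y => A y * B y) z v = delbar A z v * B z + A z * delbar B z v := by
  simp only [delbar, fderiv_mul_punctured hA hB, smul_mul_assoc, mul_smul_comm, add_mul, mul_add]
  module

variable [StarRing M] [StarModule ℂ M] [NormedStarGroup M]

theorem fderiv_star_punctured (hA : DifferentiableAt ℝ A z) :
    fderiv ℝ (fun y => star (A y)) z v = star (fderiv ℝ A z v) := by
  have := (((starL' ℝ : M ≃L[ℝ] M) : M →L[ℝ] M).hasFDerivAt.comp z hA.hasFDerivAt).fderiv
  exact congrArg (fun A => A v) this

theorem del_star (hA : DifferentiableAt ℝ A z) :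
    del (fun y => star (A y)) z v = star (delbar A z v) := by
  simp only [del, delbar, fderiv_star_punctured hA, star_smul, star_add]
  simp [sub_eq_add_neg]

theorem delbar_star (hA : DifferentiableAt ℝ A z) :
    delbar (fun y => star (A y)) z v = star (del A z v) := by
  simp only [del, delbar, fderiv_star_punctured hA, star_smul, star_sub]
  simp

end Wirtinger

/-! ## The second variation of `tr (K T)` -/

section Trace

variable {M : Type*} [NormedRing M] [NormedAlgebra ℂ M]

/-- The curvature coefficient `∂b - ∂̄a + [a, b]` of the connection form with `(1,0)`-part `a` and
`(0,1)`-part `b` in the direction `v`. -/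
def curvatureCoeff (v : C2) (a b : C2 → M) (z : C2) : M :=
  del b z v - delbar a z v + (a z * b z - b z * a z)

/-- Leibniz' rule for the connections `(a, b)` and `(a₂, b₂)`: since `K` is killed by the covariant
`∂̄`, the first derivative of `τ (K T)` only differentiates `T`. Since `T` is killed by the
covariant `∂`, the second derivative of `T` reduces to the commutator of covariant derivatives, that
is, to the curvatures. -/
theorem del_delbar_trace (τ : M →L[ℂ] ℂ) (hτ : ∀ x y, τ (x * y) = τ (y * x))
    {K T a b a₂ b₂ : C2 → M} (v : C2)
    (hK : ContDiffOn ℝ ∞ K {0}ᶜ) (hT : ContDiffOn ℝ ∞ T {0}ᶜ)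
    (ha : ContDiffOn ℝ ∞ a {0}ᶜ) (hb : ContDiffOn ℝ ∞ b {0}ᶜ)
    (ha₂ : ContDiffOn ℝ ∞ a₂ {0}ᶜ) (hb₂ : ContDiffOn ℝ ∞ b₂ {0}ᶜ)
    (hDT : ∀ z, z ≠ 0 → del T z v = T z * a z - a₂ z * T z)
    (hDK : ∀ z, z ≠ 0 → delbar K z v = K z * b₂ z - b z * K z) {z : C2} (hz : z ≠ 0) :
    del (fun y => delbar (fun x => τ (K x * T x)) y v) z v
      = τ ((del K z v + a z * K z - K z * a₂ z) * (delbar T z v + b₂ z * T z - T z * b z))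
        + τ (K z * curvatureCoeff v a₂ b₂ z * T z) - τ (K z * T z * curvatureCoeff v a b z) := by
  set Y : C2 → M := fun y => delbar T y v + b₂ y * T y - T y * b y with hYdef
  have sm := fun {f : C2 → M} (hf : ContDiffOn ℝ ∞ f {0}ᶜ) {y : C2} (hy : y ≠ 0) =>
    differentiableAt_of_punctured hf hy
  have hDbT := contDiffOn_delbar hT v
  have hY : ContDiffOn ℝ ∞ Y {0}ᶜ := (hDbT.add (hb₂.mul hT)).sub (hT.mul hb)
  have first : ∀ y, y ≠ 0 → delbar (fun x => τ (K x * T x)) y v = τ (K y * Y y) := by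
    intro y hy
    rw [delbar_clm_comp τ (sm (hK.mul hT) hy), delbar_mul (sm hK hy) (sm hT hy), hDK y hy]
    -- The correction is a commutator with `b y`, invisible to `τ`.
    have : (K y * b₂ y - b y * K y) * T y + K y * delbar T y v
        = K y * Y y + (K y * T y * b y - b y * (K y * T y)) := by
      simp only [hYdef]; noncomm_ring
    rw [this, map_add, map_sub, hτ (b y), sub_self, add_zero]
  -- Exchanging `∂` and `∂̄` lets the equation for `∂T` eliminate all second derivatives of `T`.
  have hcomm : del (fun y => delbar T y v) z v
      = delbar (fun y => T y * a y - a₂ y * T y) z v := by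
    rw [del_delbar hT hz, ← delbar_del hT hz]
    exact delbar_congr hDT hz
  have hDY : del Y z v = delbar T z v * a z + T z * delbar a z v
      - (delbar a₂ z v * T z + a₂ z * delbar T z v) + (del b₂ z v * T z + b₂ z * del T z v)
      - (del T z v * b z + T z * del b z v) := by
    rw [hYdef, del_sub ((sm hDbT hz).fun_add ((sm hb₂ hz).fun_mul (sm hT hz)))
      ((sm hT hz).fun_mul (sm hb hz)),
      del_add (sm hDbT hz) ((sm hb₂ hz).fun_mul (sm hT hz)), hcomm,
      delbar_sub ((sm hT hz).fun_mul (sm ha hz)) ((sm ha₂ hz).fun_mul (sm hT hz)),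
      delbar_mul (sm hT hz) (sm ha hz), delbar_mul (sm ha₂ hz) (sm hT hz),
      del_mul (sm hb₂ hz) (sm hT hz), del_mul (sm hT hz) (sm hb hz)]
  rw [del_congr first hz, del_clm_comp τ (sm (hK.mul hY) hz), del_mul (sm hK hz) (sm hY hz), hDY,
    hDT z hz]
  have : del K z v * Y z + K z * (delbar T z v * a z + T z * delbar a z v
      - (delbar a₂ z v * T z + a₂ z * delbar T z v)
      + (del b₂ z v * T z + b₂ z * (T z * a z - a₂ z * T z))
      - ((T z * a z - a₂ z * T z) * b z + T z * del b z v))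
    = (del K z v + a z * K z - K z * a₂ z) * Y z + K z * curvatureCoeff v a₂ b₂ z * T z
      - K z * T z * curvatureCoeff v a b z + (K z * Y z * a z - a z * (K z * Y z)) := by
    simp only [hYdef, curvatureCoeff]; noncomm_ring
  rw [this, map_add, map_sub, map_add, map_sub, hτ (a z), sub_self, add_zero]

end Trace

/-! ## The Hilbert–Schmidt matrix representation of `End(End(R))` -/

section Representation

open scoped Matrix.Norms.L2Operator Kronecker

variable (R : Type*) [NormedAddCommGroup R] [InnerProductSpace ℂ R]
  [FiniteDimensional ℂ R]

/-- The index set of a fixed orthonormal basis of `R`. -/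
abbrev Idx : Type := Fin (Module.finrank ℂ R)

/-- The algebra of matrices of operators on `End(R)`. -/
abbrev HSMat : Type := Matrix (Idx R × Idx R) (Idx R × Idx R) ℂ

variable [CompleteSpace R]

/-- The matrix of an operator in a fixed orthonormal basis of `R`. -/
def opMatrix : (R →L[ℂ] R) ≃⋆ₐ[ℂ] Matrix (Idx R) (Idx R) ℂ :=
  (StarAlgEquiv.symm
    { (LinearMap.toContinuousLinearMap : (R →ₗ[ℂ] R) ≃ₗ[ℂ] (R →L[ℂ] R)) with
      map_mul' := fun _ _ => rfl
      map_star' := fun A => by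
        have := LinearMap.adjoint_toContinuousLinearMap A
        exact this }).trans
    (LinearMap.toMatrixOrthonormal (stdOrthonormalBasis ℂ R))

/-- Coordinates on `End(R)`: the matrix entries in a fixed orthonormal basis. -/
def entries : (R →L[ℂ] R) ≃ₗ[ℂ] (Idx R × Idx R → ℂ) :=
  LinearEquiv.ofBijective
    { toFun := fun a => Matrix.vec (opMatrix R a)
      map_add' := fun a b => by rw [map_add, Matrix.vec_add]
      map_smul' := fun c a => by rw [map_smul, Matrix.vec_smul]; rfl }
    (Matrix.vec_bijective.comp (opMatrix R).bijective)

theorem entries_apply (a : R →L[ℂ] R) : entries R a = Matrix.vec (opMatrix R a) := rfl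

/-- The matrix of an operator on `End(R)`. -/
def hsRep : ((R →L[ℂ] R) →L[ℂ] (R →L[ℂ] R)) ≃ₐ[ℂ] HSMat R :=
  (Module.End.toContinuousLinearMap (R →L[ℂ] R)).symm.trans
    (((entries R).conjAlgEquiv ℂ).trans LinearMap.toMatrixAlgEquiv')

theorem hsRep_mulVec (T : (R →L[ℂ] R) →L[ℂ] (R →L[ℂ] R)) (X : R →L[ℂ] R) :
    (hsRep R T).mulVec (entries R X) = entries R (T X) := by
  have : (hsRep R T).mulVec (entries R X)
      = Matrix.toLinAlgEquiv' (LinearMap.toMatrixAlgEquiv'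
        ((entries R).conjAlgEquiv ℂ (T : (R →L[ℂ] R) →ₗ[ℂ] (R →L[ℂ] R)))) (entries R X) := rfl
  rw [this, Matrix.toLinAlgEquiv'_toMatrixAlgEquiv']
  simp [LinearEquiv.conjAlgEquiv]

/-- Vectorizing matrices turns two-sided multiplication into a Kronecker product; traces and
adjoints on `End(R)` then factor through those on `R`. -/
theorem hsRep_mulLeftRight (a b : R →L[ℂ] R) :
    hsRep R (ContinuousLinearMap.mulLeftRight ℂ (R →L[ℂ] R) a b)
      = (opMatrix R b).transpose ⊗ₖ opMatrix R a := by
  apply Matrix.toLin'.injective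
  refine LinearMap.ext fun x => ?_
  obtain ⟨X, hX⟩ := (entries R).surjective x
  simp only [Matrix.toLin'_apply]
  rw [← hX, hsRep_mulVec, entries_apply, entries_apply, Matrix.kronecker_mulVec_vec,
    Matrix.transpose_transpose, ContinuousLinearMap.mulLeftRight_apply, map_mul, map_mul]

theorem star_hsRep_mulLeftRight (a b : R →L[ℂ] R) :
    star (hsRep R (ContinuousLinearMap.mulLeftRight ℂ (R →L[ℂ] R) a b))
      = hsRep R (ContinuousLinearMap.mulLeftRight ℂ (R →L[ℂ] R) (star a) (star b)) := by
  rw [hsRep_mulLeftRight, hsRep_mulLeftRight, Matrix.star_eq_conjTranspose,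
    Matrix.conjTranspose_kronecker, map_star, map_star]
  rfl

theorem trace_hsRep_mulLeftRight (a b : R →L[ℂ] R) :
    (hsRep R (ContinuousLinearMap.mulLeftRight ℂ (R →L[ℂ] R) a b)).trace
      = (opMatrix R a).trace * (opMatrix R b).trace := by
  rw [hsRep_mulLeftRight, Matrix.trace_kronecker, Matrix.trace_transpose, mul_comm]

/-- `hsRep` as a continuous linear map. -/
def hsRepL : ((R →L[ℂ] R) →L[ℂ] (R →L[ℂ] R)) →L[ℂ] HSMat R :=
  LinearMap.toContinuousLinearMap (hsRep R).toLinearMap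

/-- The inverse of `hsRep` as a continuous linear map. -/
def hsRepInvL : HSMat R →L[ℂ] ((R →L[ℂ] R) →L[ℂ] (R →L[ℂ] R)) :=
  LinearMap.toContinuousLinearMap (hsRep R).symm.toLinearMap

theorem hsRepL_apply (T : (R →L[ℂ] R) →L[ℂ] (R →L[ℂ] R)) : hsRepL R T = hsRep R T := rfl

theorem hsRepInvL_apply (A : HSMat R) : hsRepInvL R A = (hsRep R).symm A := rfl

end Representation

/-! ### The matrix trace and the positivity of `tr (A^* A)` -/

open scoped Matrix.Norms.L2Operator in
/-- The trace as a continuous linear map. -/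
def traceL (n : Type*) [Fintype n] [DecidableEq n] : Matrix n n ℂ →L[ℂ] ℂ :=
  LinearMap.toContinuousLinearMap (Matrix.traceLinearMap n ℂ ℂ)

theorem traceL_apply {n : Type*} [Fintype n] [DecidableEq n] (A : Matrix n n ℂ) :
    traceL n A = A.trace := rfl

theorem traceL_mul_comm {n : Type*} [Fintype n] [DecidableEq n] (A B : Matrix n n ℂ) :
    traceL n (A * B) = traceL n (B * A) :=
  Matrix.trace_mul_comm A B

open scoped ComplexOrder in
theorem trace_star_mul_self_re_nonneg {n : Type*} [Fintype n] (A : Matrix n n ℂ) :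
    0 ≤ (Matrix.trace (star A * A)).re := by
  have := (Matrix.posSemidef_conjTranspose_mul_self A).trace_nonneg
  exact (Complex.le_def.1 this).1

open scoped ComplexOrder in
theorem trace_star_mul_self_im {n : Type*} [Fintype n] (A : Matrix n n ℂ) :
    (Matrix.trace (star A * A)).im = 0 := by
  have := (Matrix.posSemidef_conjTranspose_mul_self A).trace_nonneg
  exact (Complex.le_def.1 this).2.symm

open scoped ComplexOrder in
theorem eq_zero_of_trace_star_mul_self_re {n : Type*} [Fintype n] {A : Matrix n n ℂ}
    (h : (Matrix.trace (star A * A)).re = 0) : A = 0 :=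
  Matrix.trace_conjTranspose_mul_self_eq_zero_iff.1 (Complex.ext h (trace_star_mul_self_im A))

/-! ## Pointwise algebra of the moment map terms -/

section Pointwise

open scoped Matrix

variable {n : Type*} [Fintype n] [DecidableEq n]

/-- The variation of `tr (k kᴴ [A, Aᴴ])` along a complex orbit is a square. -/
theorem trace_commutator_variation {k A B : Matrix n n ℂ} (h : A * k = k * B) :
    (k * kᴴ * (A * Aᴴ - Aᴴ * A)).trace - (kᴴ * k * (B * Bᴴ - Bᴴ * B)).trace
      = (star (kᴴ * A - B * kᴴ) * (kᴴ * A - B * kᴴ)).trace := by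
  have h' : kᴴ * Aᴴ = Bᴴ * kᴴ := by
    rw [← Matrix.conjTranspose_mul, h, Matrix.conjTranspose_mul]
  -- The four traces are rotated cyclically into the four terms of the expanded square; `A k = k B`
  -- is needed only for the cross terms `e2` and `e3`.
  have e1 : (k * kᴴ * (A * Aᴴ)).trace = (Aᴴ * k * kᴴ * A).trace := by
    rw [← Matrix.mul_assoc, Matrix.trace_mul_comm]; simp only [Matrix.mul_assoc]
  have e2 : (k * kᴴ * (Aᴴ * A)).trace = (Aᴴ * k * (B * kᴴ)).trace := by
    rw [Matrix.mul_assoc, Matrix.trace_mul_comm]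
    calc (kᴴ * (Aᴴ * A) * k).trace = (kᴴ * Aᴴ * (A * k)).trace := by simp only [Matrix.mul_assoc]
      _ = (kᴴ * (Aᴴ * k * B)).trace := by rw [h]; simp only [Matrix.mul_assoc]
      _ = _ := by rw [Matrix.trace_mul_comm]; simp only [Matrix.mul_assoc]
  have e3 : (kᴴ * k * (B * Bᴴ)).trace = (k * Bᴴ * (kᴴ * A)).trace := by
    calc (kᴴ * k * (B * Bᴴ)).trace = (kᴴ * (A * k) * Bᴴ).trace := by
          rw [h]; simp only [Matrix.mul_assoc]
      _ = (kᴴ * A * (k * Bᴴ)).trace := by simp only [Matrix.mul_assoc]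
      _ = _ := Matrix.trace_mul_comm _ _
  have e4 : (kᴴ * k * (Bᴴ * B)).trace = (k * Bᴴ * B * kᴴ).trace := by
    rw [Matrix.mul_assoc, Matrix.trace_mul_comm]; simp only [Matrix.mul_assoc]
  have e5 : star (kᴴ * A - B * kᴴ) * (kᴴ * A - B * kᴴ)
      = Aᴴ * k * kᴴ * A - Aᴴ * k * (B * kᴴ) - (k * Bᴴ * (kᴴ * A) - k * Bᴴ * B * kᴴ) := by
    simp only [Matrix.star_eq_conjTranspose, Matrix.conjTranspose_sub, Matrix.conjTranspose_mul,
      Matrix.conjTranspose_conjTranspose]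
    noncomm_ring
  rw [e5, mul_sub, mul_sub, Matrix.trace_sub, Matrix.trace_sub, Matrix.trace_sub,
    Matrix.trace_sub, Matrix.trace_sub, e1, e2, e3, e4]

end Pointwise

/-! ### The moment map terms paired with a gauge transformation -/

section Moment

open scoped Matrix Matrix.Norms.L2Operator

variable {Γ : Subgroup SU2} {R : Type*} [NormedAddCommGroup R] [InnerProductSpace ℂ R]
  [CompleteSpace R]

local notation "LR" => ContinuousLinearMap.mulLeftRight ℂ (R →L[ℂ] R)

theorem mulLeftRight_mul (a b c d : R →L[ℂ] R) : LR a b * LR c d = LR (a * c) (d * b) := by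
  ext1 X
  simp [mul_assoc]

theorem ad_eq (X : R →L[ℂ] R) : ad X = LR X 1 - LR 1 X := by
  ext1 Y
  simp [ad]

variable [FiniteDimensional ℂ R]

/-- Elements of the centre commute with the commutant of `Γ`. -/
theorem commute_of_mem_centre (ϱ : Γ →* unitary (R →L[ℂ] R)) {ζ : R →L[ℂ] R}
    (hζ : ζ ∈ centre ϱ) {X : R →L[ℂ] R}
    (hX : ∀ γ : Γ, X * (ϱ γ : R →L[ℂ] R) = (ϱ γ : R →L[ℂ] R) * X)
    (hXs : ∀ γ : Γ, star X * (ϱ γ : R →L[ℂ] R) = (ϱ γ : R →L[ℂ] R) * star X) :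
    ζ * X = X * ζ := by
  have tr_eq : ∀ Y : R →L[ℂ] R, LinearMap.trace ℂ R (Y : R →ₗ[ℂ] R) = (opMatrix R Y).trace :=
    fun Y => LinearMap.trace_eq_matrix_trace ℂ (stdOrthonormalBasis ℂ R).toBasis _
  -- The zero space is set apart because the dimension is divided by below.
  by_cases hn : Module.finrank ℂ R = 0
  · have := Module.finrank_zero_iff.1 hn
    exact Subsingleton.elim _ _
  have hn' : (Module.finrank ℂ R : ℂ) ≠ 0 := Nat.cast_ne_zero.2 hn
  have skew : ∀ Y : R →L[ℂ] R, star Y = -Y →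
      (∀ γ : Γ, Y * (ϱ γ : R →L[ℂ] R) = (ϱ γ : R →L[ℂ] R) * Y) → ζ * Y = Y * ζ := by
    intro Y hY hc
    set t := (opMatrix R Y).trace with ht
    have hst : star t = -t := by
      rw [ht, ← Matrix.trace_conjTranspose, ← Matrix.star_eq_conjTranspose, ← map_star, hY,
        map_neg, Matrix.trace_neg]
    -- The centre is tested on traceless elements only; subtracting a scalar does not affect
    -- commutation with `ζ`.
    have h := hζ.2 (Y - (t / Module.finrank ℂ R) • 1) ⟨?_, ?_, ?_⟩
    · simpa [mul_sub, sub_mul] using h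
    · rw [star_sub, star_smul, hY, star_div₀, hst, star_one, star_natCast]
      module
    · intro γ
      rw [sub_mul, mul_sub, hc γ]
      simp
    · rw [tr_eq, map_sub, map_smul, map_one, Matrix.trace_sub, Matrix.trace_smul, Matrix.trace_one,
        ← ht]
      simp [hn']
  -- A general `X` is a complex combination of the skew elements `X - X^*` and `i (X + X^*)`.
  have h1 := skew (X - star X) (by simp) fun γ => by rw [sub_mul, mul_sub, hX, hXs]
  have h2 := skew (Complex.I • (X + star X)) (by simp [add_comm]) fun γ => by
    rw [smul_mul_assoc, mul_smul_comm, add_mul, mul_add, hX, hXs]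
  rw [smul_mul_assoc, mul_smul_comm] at h2
  have h3 := smul_right_injective _ Complex.I_ne_zero h2
  have h4 : (2 : ℂ) • (ζ * X) = (2 : ℂ) • (X * ζ) := by
    have := congrArg₂ (· + ·) h1 h3
    simp only [mul_sub, sub_mul, mul_add, add_mul] at this
    rw [two_smul, two_smul]
    calc ζ * X + ζ * X = ζ * X - ζ * star X + (ζ * X + ζ * star X) := by abel
      _ = _ := this
      _ = _ := by abel
  exact smul_right_injective _ (two_ne_zero (α := ℂ)) h4

/-- Conjugating by `ϱ γ` under the trace leaves `g` unchanged. Thus the averaged commutator in the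
moment map equation may be replaced by the commutator itself when paired with the commutant. -/
theorem trace_average_mul [Fintype Γ] (ϱ : Γ →* unitary (R →L[ℂ] R)) (X g : R →L[ℂ] R)
    (hg : ∀ γ : Γ, g * (ϱ γ : R →L[ℂ] R) = (ϱ γ : R →L[ℂ] R) * g) :
    (opMatrix R (g * average ϱ X)).trace = (opMatrix R (g * X)).trace := by
  have h : ∀ γ : Γ, (opMatrix R (g * ((ϱ γ : R →L[ℂ] R) * X
      * (ϱ γ⁻¹ : unitary (R →L[ℂ] R))))).trace = (opMatrix R (g * X)).trace := by
    intro γ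
    have h1 : ((ϱ γ⁻¹ : unitary (R →L[ℂ] R)) : R →L[ℂ] R) * (ϱ γ : R →L[ℂ] R) = 1 := by
      rw [← Submonoid.coe_mul, ← map_mul, inv_mul_cancel, map_one, Submonoid.coe_one]
    rw [← mul_assoc, ← mul_assoc, hg, map_mul, Matrix.trace_mul_comm, ← map_mul, ← mul_assoc,
      ← mul_assoc, h1, one_mul]
  rw [average, mul_smul_comm, Finset.mul_sum, map_smul, map_sum, Matrix.trace_smul,
    Matrix.trace_sum, Finset.sum_congr rfl fun γ _ => h γ, Finset.sum_const, Finset.card_univ,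
    nsmul_eq_mul, smul_eq_mul, ← mul_assoc, inv_mul_cancel₀, one_mul]
  exact Nat.cast_ne_zero.2 Fintype.card_ne_zero

/-- Left and right multiplication by `X` are the two summands of `ad X`, and the trace of each
resulting Kronecker product is a product of traces on `R`. The same computation gives
`trace_mul_ad`. -/
theorem trace_conj_ad (f g X : R →L[ℂ] R) :
    (hsRep R (LR f g) * hsRep R (ad X) * hsRep R (LR (star f) (star g))).trace
      = (opMatrix R (star f * f * X)).trace * (opMatrix R (star g * g)).trace
        - (opMatrix R (star f * f)).trace * (opMatrix R (g * star g * X)).trace := by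
  rw [← map_mul, ← map_mul, ad_eq, mul_sub, sub_mul, map_sub, Matrix.trace_sub]
  simp only [mulLeftRight_mul, trace_hsRep_mulLeftRight, mul_one, one_mul]
  congr 2
  · rw [map_mul, Matrix.trace_mul_comm, ← map_mul, mul_assoc]
  · rw [map_mul, Matrix.trace_mul_comm, ← map_mul]
  · rw [map_mul, Matrix.trace_mul_comm, ← map_mul, mul_assoc X, map_mul, Matrix.trace_mul_comm,
      ← map_mul]

theorem trace_mul_ad (f g X : R →L[ℂ] R) :
    (hsRep R (LR f g) * hsRep R (LR (star f) (star g)) * hsRep R (ad X)).trace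
      = (opMatrix R (f * star f * X)).trace * (opMatrix R (star g * g)).trace
        - (opMatrix R (star f * f)).trace * (opMatrix R (star g * g * X)).trace := by
  rw [← map_mul, ← map_mul, ad_eq, mul_sub, map_sub, Matrix.trace_sub]
  simp only [mulLeftRight_mul, trace_hsRep_mulLeftRight, mul_one, one_mul]
  congr 2
  · rw [map_mul, Matrix.trace_mul_comm, ← map_mul]
  · rw [map_mul, Matrix.trace_mul_comm, ← map_mul]

set_option maxHeartbeats 1000000 in
/-- The moment map term in the Laplacian of `tr (κ κ^*)` is a nonnegative multiple of a sum of
squares. -/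
theorem exists_moment_variation [Fintype Γ] (ϱ : Γ →* unitary (R →L[ℂ] R)) {ζ : R →L[ℂ] R}
    (hζ : ζ ∈ centre ϱ) (f : Fc ϱ) {A B : R →L[ℂ] R}
    (h : A * ((f : (R →L[ℂ] R)ˣ) : R →L[ℂ] R) = ((f : (R →L[ℂ] R)ˣ) : R →L[ℂ] R) * B) :
    ∃ N : ℝ, 0 ≤ N ∧ (N = 0 → star ((f : (R →L[ℂ] R)ˣ) : R →L[ℂ] R) * A
        = B * star ((f : (R →L[ℂ] R)ˣ) : R →L[ℂ] R)) ∧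
      ∀ (μ : ℝ) (K T : HSMat R),
        K = hsRep R (LR ((f : (R →L[ℂ] R)ˣ) : R →L[ℂ] R) ((f⁻¹ : (R →L[ℂ] R)ˣ) : R →L[ℂ] R)) →
        T = star K →
        (K * hsRep R ((Complex.I * μ / 2) • ad ζ
            - (μ / 4 : ℂ) • ad (average ϱ (B * star B - star B * B))) * T).trace
          - (K * T * hsRep R ((Complex.I * μ / 2) • ad ζ
            - (μ / 4 : ℂ) • ad (average ϱ (A * star A - star A * A)))).trace
          = ((μ / 4 * N : ℝ) : ℂ) := by
  set F : R →L[ℂ] R := ((f : (R →L[ℂ] R)ˣ) : R →L[ℂ] R) with hF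
  set G : R →L[ℂ] R := ((f⁻¹ : (R →L[ℂ] R)ˣ) : R →L[ℂ] R) with hG
  have hFG : F * G = 1 := Units.mul_inv _
  have hGF : G * F = 1 := Units.inv_mul _
  -- The inverse intertwines the sections in the opposite direction. As `Ad f` is built from both
  -- `F` and `G`, each contributes its own square.
  have h' : B * G = G * A := by
    calc B * G = G * F * B * G := by rw [hGF, one_mul]
      _ = G * (A * F) * G := by rw [h, mul_assoc G F B]
      _ = G * A * (F * G) := by simp only [mul_assoc]
      _ = G * A := by rw [hFG, mul_one]
  have cF := f.2
  have cFs := fun γ => star_comm ϱ f γ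
  have cG : ∀ γ : Γ, G * (ϱ γ : R →L[ℂ] R) = (ϱ γ : R →L[ℂ] R) * G := (f⁻¹).2
  have cGs : ∀ γ : Γ, star G * (ϱ γ : R →L[ℂ] R) = (ϱ γ : R →L[ℂ] R) * star G :=
    fun γ => star_comm ϱ f⁻¹ γ
  have cmul : ∀ {a b : R →L[ℂ] R}, (∀ γ : Γ, a * (ϱ γ : R →L[ℂ] R) = (ϱ γ : R →L[ℂ] R) * a) →
      (∀ γ : Γ, b * (ϱ γ : R →L[ℂ] R) = (ϱ γ : R →L[ℂ] R) * b) →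
      ∀ γ : Γ, (a * b) * (ϱ γ : R →L[ℂ] R) = (ϱ γ : R →L[ℂ] R) * (a * b) := by
    intro a b ha hb γ
    rw [mul_assoc, hb, ← mul_assoc, ha, mul_assoc]
  set k := opMatrix R F with hk
  set k' := opMatrix R G with hk'
  set a := opMatrix R A with ha
  set b := opMatrix R B with hb
  have sa := fun X : R →L[ℂ] R => map_star (opMatrix R) X
  set N₁ := (star (kᴴ * a - b * kᴴ) * (kᴴ * a - b * kᴴ)).trace with hN₁
  set N₂ := (star (k'ᴴ * b - a * k'ᴴ) * (k'ᴴ * b - a * k'ᴴ)).trace with hN₂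
  set n₁ := (star k' * k').trace with hn₁
  set n₂ := (star k * k).trace with hn₂
  have r1 : N₁ = (N₁.re : ℂ) := Complex.ext rfl (by simpa using trace_star_mul_self_im _)
  have r2 : N₂ = (N₂.re : ℂ) := Complex.ext rfl (by simpa using trace_star_mul_self_im _)
  have r3 : n₁ = (n₁.re : ℂ) := Complex.ext rfl (by simpa using trace_star_mul_self_im _)
  have r4 : n₂ = (n₂.re : ℂ) := Complex.ext rfl (by simpa using trace_star_mul_self_im _)
  have p1 : 0 ≤ N₁.re := trace_star_mul_self_re_nonneg _
  have p2 : 0 ≤ N₂.re := trace_star_mul_self_re_nonneg _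
  have p3 : 0 ≤ n₁.re := trace_star_mul_self_re_nonneg _
  have p4 : 0 ≤ n₂.re := trace_star_mul_self_re_nonneg _
  -- The squares for `F` and for `G`, each weighted by the squared Hilbert–Schmidt norm of the other
  -- factor.
  refine ⟨N₁.re * n₁.re + n₂.re * N₂.re,
    add_nonneg (mul_nonneg p1 p3) (mul_nonneg p4 p2), ?_, ?_⟩
  · intro h0
    have h1 : N₁.re * n₁.re = 0 := by
      have := mul_nonneg p1 p3
      have := mul_nonneg p4 p2
      linarith
    apply EquivLike.injective (opMatrix R)
    rw [map_mul, map_mul, sa]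
    rcases mul_eq_zero.1 h1 with h2 | h2
    · exact sub_eq_zero.1 (eq_zero_of_trace_star_mul_self_re h2)
    -- The weight `n₁` vanishes only if the inverse `G` is zero, which forces `1 = 0`; then all
    -- matrices agree.
    · have h3 : k' = 0 := eq_zero_of_trace_star_mul_self_re h2
      have h4 : (1 : Matrix (Idx R) (Idx R) ℂ) = 0 := by
        rw [← map_one (opMatrix R), ← hFG, map_mul, ← hk', h3, mul_zero]
      exact eq_of_zero_eq_one h4.symm _ _
  · intro μ K T hK hT
    have hT' : T = hsRep R (LR (star F) (star G)) := by
      rw [hT, hK, star_hsRep_mulLeftRight]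
    have v1 := trace_commutator_variation (k := k) (A := a) (B := b)
      (by rw [hk, ha, hb, ← map_mul, ← map_mul, h])
    have v2 := trace_commutator_variation (k := k') (A := b) (B := a)
      (by rw [hk', ha, hb, ← map_mul, ← map_mul, h'])
    -- Centrality of `ζ` makes `ad ζ` commute with `T`, so the `ζ` terms of the two curvatures
    -- cancel.
    have z0 : (K * hsRep R (ad ζ) * T).trace = (K * T * hsRep R (ad ζ)).trace := by
      rw [hT', hK, mul_assoc, ← map_mul (hsRep R) (ad ζ), mul_assoc, ← map_mul (hsRep R) _ (ad ζ)]
      congr 3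
      have zFs : star F * ζ = ζ * star F :=
        (commute_of_mem_centre ϱ hζ cFs fun γ => by rw [star_star]; exact cF γ).symm
      have zGs : star G * ζ = ζ * star G :=
        (commute_of_mem_centre ϱ hζ cGs fun γ => by rw [star_star]; exact cG γ).symm
      simp only [ad_eq, mul_sub, sub_mul, mulLeftRight_mul, one_mul, mul_one, zFs, zGs]
    have q1 : (opMatrix R (star G * G)).trace = n₁ := by rw [map_mul, sa]
    have q2 : (opMatrix R (star F * F)).trace = n₂ := by rw [map_mul, sa]
    have q3 : (opMatrix R (star F * F * (B * star B - star B * B))).trace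
        = (kᴴ * k * (b * bᴴ - bᴴ * b)).trace := by
      simp only [map_mul, map_sub, sa]; rfl
    have q4 : (opMatrix R (G * star G * (B * star B - star B * B))).trace
        = (k' * k'ᴴ * (b * bᴴ - bᴴ * b)).trace := by
      simp only [map_mul, map_sub, sa]; rfl
    have q5 : (opMatrix R (F * star F * (A * star A - star A * A))).trace
        = (k * kᴴ * (a * aᴴ - aᴴ * a)).trace := by
      simp only [map_mul, map_sub, sa]; rfl
    have q6 : (opMatrix R (star G * G * (A * star A - star A * A))).trace
        = (k'ᴴ * k' * (a * aᴴ - aᴴ * a)).trace := by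
      simp only [map_mul, map_sub, sa]; rfl
    have m1 : (K * hsRep R (ad (average ϱ (B * star B - star B * B))) * T).trace
        = (kᴴ * k * (b * bᴴ - bᴴ * b)).trace * n₁
          - n₂ * (k' * k'ᴴ * (b * bᴴ - bᴴ * b)).trace := by
      rw [hT', hK, trace_conj_ad, trace_average_mul _ _ _ (cmul cFs cF),
        trace_average_mul _ _ _ (cmul cG cGs), q1, q2, q3, q4]
    have m2 : (K * T * hsRep R (ad (average ϱ (A * star A - star A * A)))).trace
        = (k * kᴴ * (a * aᴴ - aᴴ * a)).trace * n₁
          - n₂ * (k'ᴴ * k' * (a * aᴴ - aᴴ * a)).trace := by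
      rw [hT', hK, trace_mul_ad, trace_average_mul _ _ _ (cmul cF cFs),
        trace_average_mul _ _ _ (cmul cGs cG), q1, q2, q5, q6]
    have e1 : ((μ / 4 * (N₁.re * n₁.re + n₂.re * N₂.re) : ℝ) : ℂ)
        = μ / 4 * (N₁ * n₁ + n₂ * N₂) := by
      push_cast
      rw [← r1, ← r2, ← r3, ← r4]
    rw [e1, hN₁, hN₂, ← v1, ← v2]
    simp only [map_sub, map_smul, mul_sub, sub_mul, mul_smul_comm, smul_mul_assoc,
      Matrix.trace_sub, Matrix.trace_smul, z0, m1, m2, smul_eq_mul]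
    ring

end Moment

/-! ## Types of one-forms -/

theorem I_mul_half_I : Complex.I * (2⁻¹ * Complex.I) = -2⁻¹ := by
  linear_combination (2⁻¹ : ℂ) * Complex.I_mul_I

theorem differentiableAt_clm_comp {W W' : Type*} [NormedAddCommGroup W] [NormedSpace ℂ W]
    [NormedAddCommGroup W'] [NormedSpace ℂ W'] (L : W →L[ℂ] W') {f : C2 → W} {z : C2}
    (hf : DifferentiableAt ℝ f z) : DifferentiableAt ℝ (fun y => L (f y)) z :=
  (L.restrictScalars ℝ).differentiableAt.comp z hf

theorem half_smul_sub_I_smul {W : Type*} [AddCommGroup W] [Module ℂ W] (P Q : W) :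
    (2⁻¹ : ℂ) • (P + Q - Complex.I • (Complex.I • P - Complex.I • Q)) = P := by
  rw [← smul_sub, smul_smul, Complex.I_mul_I]
  module

theorem half_smul_add_I_smul {W : Type*} [AddCommGroup W] [Module ℂ W] (P Q : W) :
    (2⁻¹ : ℂ) • (P + Q + Complex.I • (Complex.I • P - Complex.I • Q)) = Q := by
  rw [← smul_sub, smul_smul, Complex.I_mul_I]
  module

section Forms

variable {R : Type*} [NormedAddCommGroup R] [InnerProductSpace ℂ R] [CompleteSpace R]

theorem del_I_smul {W : Type*} [NormedAddCommGroup W] [NormedSpace ℂ W] (f : C2 → W) (z v : C2) :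
    del f z (Complex.I • v) = Complex.I • del f z v := by
  simp only [del, smul_smul, Complex.I_mul_I, neg_smul, one_smul, map_neg, smul_neg, smul_sub]
  rw [I_mul_half_I]
  module

theorem delbar_I_smul {W : Type*} [NormedAddCommGroup W] [NormedSpace ℂ W] (f : C2 → W)
    (z v : C2) : delbar f z (Complex.I • v) = -(Complex.I • delbar f z v) := by
  simp only [delbar, smul_smul, Complex.I_mul_I, neg_smul, one_smul, map_neg, smul_neg, smul_add]
  rw [I_mul_half_I]
  module

/-- Additivity of a one-form at the points of `ℂ² ∖ {0}`. -/
def OneForm.IsAdditive (B : OneForm R) : Prop :=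
  ∀ z : C2, z ≠ 0 → ∀ v w : C2, B z (v + w) = B z v + B z w

theorem OneForm.IsAdditive.map_neg {B : OneForm R} (hB : B.IsAdditive) {z : C2} (hz : z ≠ 0)
    (v : C2) : B z (-v) = -B z v := by
  have h0 : B z 0 = 0 := by simpa using hB z hz 0 0
  have := hB z hz v (-v)
  rw [add_neg_cancel, h0] at this
  exact (neg_eq_of_add_eq_zero_right this.symm).symm

theorem OneForm.part10_add_part01 (B : OneForm R) (z v : C2) :
    B.part10 z v + B.part01 z v = B z v := by
  simp only [OneForm.part10, OneForm.part01]
  module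

theorem OneForm.IsAdditive.part10_I_smul {B : OneForm R} (hB : B.IsAdditive) {z : C2} (hz : z ≠ 0)
    (v : C2) : B.part10 z (Complex.I • v) = Complex.I • B.part10 z v := by
  simp only [OneForm.part10, smul_smul, Complex.I_mul_I, neg_smul, one_smul, hB.map_neg hz,
    smul_neg, smul_sub]
  rw [I_mul_half_I]
  module

theorem OneForm.IsAdditive.part01_I_smul {B : OneForm R} (hB : B.IsAdditive) {z : C2} (hz : z ≠ 0)
    (v : C2) : B.part01 z (Complex.I • v) = -(Complex.I • B.part01 z v) := by
  simp only [OneForm.part01, smul_smul, Complex.I_mul_I, neg_smul, one_smul, hB.map_neg hz,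
    smul_neg, smul_add]
  rw [I_mul_half_I]
  module

theorem OneForm.IsAdditive.part10_add {B : OneForm R} (hB : B.IsAdditive) {z : C2} (hz : z ≠ 0)
    (v w : C2) : B.part10 z (v + w) = B.part10 z v + B.part10 z w := by
  simp only [OneForm.part10, smul_add, hB z hz]
  module

theorem OneForm.IsAdditive.part01_add {B : OneForm R} (hB : B.IsAdditive) {z : C2} (hz : z ≠ 0)
    (v w : C2) : B.part01 z (v + w) = B.part01 z v + B.part01 z w := by
  simp only [OneForm.part01, smul_add, hB z hz]
  module

theorem isAdditive_zero : (0 : OneForm R).IsAdditive := fun z _ v w => by simp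

variable {Γ : Subgroup SU2} {ϱ : Γ →* unitary (R →L[ℂ] R)}

theorem ComplexGauge.actForm_isAdditive (κ : ComplexGauge ϱ) {B : OneForm R}
    (hB : B.IsAdditive) : (κ.actForm B).IsAdditive := by
  intro z hz v w
  simp only [ComplexGauge.actForm, hB.part10_add hz, hB.part01_add hz, del_add_right,
    delbar_add_right]
  noncomm_ring

/-- The `∂` summand is complex linear in `v` and the `∂̄` summand antilinear, so the two types can
be read off separately. -/
theorem ComplexGauge.actForm_I_smul (κ : ComplexGauge ϱ) {B : OneForm R} (hB : B.IsAdditive)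
    {z : C2} (hz : z ≠ 0) (v : C2) : κ.actForm B z (Complex.I • v)
      = Complex.I • (pullback (fun x => Ad ϱ (starInv ϱ (κ.toFun x))⁻¹) z
        * (del (pullback fun x => Ad ϱ (starInv ϱ (κ.toFun x))) z v
          + B.part10 z v * pullback (fun x => Ad ϱ (starInv ϱ (κ.toFun x))) z))
      - Complex.I • (pullback (fun x => Ad ϱ (κ.toFun x)⁻¹) z
        * (delbar (pullback fun x => Ad ϱ (κ.toFun x)) z v
          + B.part01 z v * pullback (fun x => Ad ϱ (κ.toFun x)) z)) := by
  simp only [ComplexGauge.actForm, hB.part10_I_smul hz, hB.part01_I_smul hz, del_I_smul,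
    delbar_I_smul, smul_mul_assoc, ← smul_add, ← neg_add, neg_mul, mul_smul_comm, mul_neg]
  rw [← sub_eq_add_neg]

theorem ComplexGauge.part10_actForm (κ : ComplexGauge ϱ) {B : OneForm R} (hB : B.IsAdditive)
    {z : C2} (hz : z ≠ 0) (v : C2) : (κ.actForm B).part10 z v
      = pullback (fun x => Ad ϱ (starInv ϱ (κ.toFun x))⁻¹) z
        * (del (pullback fun x => Ad ϱ (starInv ϱ (κ.toFun x))) z v
          + B.part10 z v * pullback (fun x => Ad ϱ (starInv ϱ (κ.toFun x))) z) := by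
  rw [OneForm.part10, κ.actForm_I_smul hB hz]
  exact half_smul_sub_I_smul _ _

theorem ComplexGauge.part01_actForm (κ : ComplexGauge ϱ) {B : OneForm R} (hB : B.IsAdditive)
    {z : C2} (hz : z ≠ 0) (v : C2) : (κ.actForm B).part01 z v
      = pullback (fun x => Ad ϱ (κ.toFun x)⁻¹) z
      * (delbar (pullback fun x => Ad ϱ (κ.toFun x)) z v
        + B.part01 z v * pullback (fun x => Ad ϱ (κ.toFun x)) z) := by
  rw [OneForm.part01, κ.actForm_I_smul hB hz]
  exact half_smul_add_I_smul _ _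

/-- No linearity in `v` is built into `OneForm`; it is inherited from the differentials of the `κ`
that defines a connection of `𝒜^F`. -/
theorem Configuration.isAdditive (x : Configuration ϱ) : x.B.IsAdditive := by
  obtain ⟨κ, h⟩ := x.mem
  intro z hz v w
  rw [h z hz, h z hz, h z hz, κ.actForm_isAdditive isAdditive_zero z hz]

end Forms

/-! ### Gauge transformations, connections and curvature as matrices -/

section Gauge

open scoped Matrix.Norms.L2Operator

variable {Γ : Subgroup SU2} {R : Type*} [NormedAddCommGroup R] [InnerProductSpace ℂ R]
  [FiniteDimensional ℂ R] [CompleteSpace R] {ϱ : Γ →* unitary (R →L[ℂ] R)}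

local notation "LR" => ContinuousLinearMap.mulLeftRight ℂ (R →L[ℂ] R)

theorem pullback_of_ne {W : Type*} [Zero W] (f : CP1 → W) {z : C2} (hz : z ≠ 0) :
    pullback f z = f (Projectivization.mk ℂ z hz) := by
  simp [pullback, hz]

/-- The matrix of the conjugation action of `F^c / ℂ^*`. -/
def gaugeRep (ϱ : Γ →* unitary (R →L[ℂ] R)) : PFc ϱ →* HSMat R :=
  (MonoidHomClass.toMonoidHom (hsRep R)).comp (Ad ϱ)

theorem gaugeRep_mk (f : Fc ϱ) : gaugeRep ϱ (f : PFc ϱ)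
    = hsRep R (LR ((f : (R →L[ℂ] R)ˣ) : R →L[ℂ] R) ((f⁻¹ : (R →L[ℂ] R)ˣ) : R →L[ℂ] R)) := rfl

theorem gaugeRep_mul_inv (k : PFc ϱ) : gaugeRep ϱ k * gaugeRep ϱ k⁻¹ = 1 := by
  rw [← map_mul, mul_inv_cancel, map_one]

theorem gaugeRep_inv_mul (k : PFc ϱ) : gaugeRep ϱ k⁻¹ * gaugeRep ϱ k = 1 := by
  rw [← map_mul, inv_mul_cancel, map_one]

/-- The adjoint of conjugation by `f`, for the Hilbert–Schmidt metric, is conjugation by `f^*`; the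
abstract `κ^*` becomes the matrix adjoint. -/
theorem gaugeRep_starInv_inv (k : PFc ϱ) :
    gaugeRep ϱ (starInv ϱ k)⁻¹ = star (gaugeRep ϱ k) := by
  induction k using QuotientGroup.induction_on with
  | H f =>
    rw [gaugeRep_mk, star_hsRep_mulLeftRight]
    have : (starInv ϱ (f : PFc ϱ))⁻¹ = (((starInvFc ϱ f)⁻¹ : Fc ϱ) : PFc ϱ) := rfl
    rw [this, gaugeRep_mk]
    simp only [starInvFc, MonoidHom.coe_mk, OneHom.coe_mk, inv_inv]
    rfl

/-- The matrix valued function on `ℂ² ∖ {0}` defined by a map `ℂP¹ → F^c / ℂ^*`. -/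
def gaugeMat (ϱ : Γ →* unitary (R →L[ℂ] R)) (φ : CP1 → PFc ϱ) (z : C2) : HSMat R :=
  hsRepL R (pullback (fun x => Ad ϱ (φ x)) z)

theorem gaugeMat_of_ne (φ : CP1 → PFc ϱ) {z : C2} (hz : z ≠ 0) :
    gaugeMat ϱ φ z = gaugeRep ϱ (φ (Projectivization.mk ℂ z hz)) := by
  rw [gaugeMat, pullback_of_ne _ hz]; rfl

theorem gaugeMat_mul_inv (φ : CP1 → PFc ϱ) {z : C2} (hz : z ≠ 0) :
    gaugeMat ϱ φ z * gaugeMat ϱ (fun x => (φ x)⁻¹) z = 1 := by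
  rw [gaugeMat_of_ne _ hz, gaugeMat_of_ne _ hz, gaugeRep_mul_inv]

theorem gaugeMat_inv_mul (φ : CP1 → PFc ϱ) {z : C2} (hz : z ≠ 0) :
    gaugeMat ϱ (fun x => (φ x)⁻¹) z * gaugeMat ϱ φ z = 1 := by
  rw [gaugeMat_of_ne _ hz, gaugeMat_of_ne _ hz, gaugeRep_inv_mul]

theorem gaugeMat_starInv_inv (φ : CP1 → PFc ϱ) {z : C2} (hz : z ≠ 0) :
    gaugeMat ϱ (fun x => (starInv ϱ (φ x))⁻¹) z = star (gaugeMat ϱ φ z) := by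
  rw [gaugeMat_of_ne _ hz, gaugeMat_of_ne _ hz, gaugeRep_starInv_inv]

theorem pullback_eq_hsRepInvL (φ : CP1 → PFc ϱ) :
    pullback (fun x => Ad ϱ (φ x)) = fun z => hsRepInvL R (gaugeMat ϱ φ z) := by
  funext z
  rw [gaugeMat, hsRepL_apply, hsRepInvL_apply, AlgEquiv.symm_apply_apply]

theorem contDiffOn_pullback_iff (φ : CP1 → PFc ϱ) :
    ContDiffOn ℝ ∞ (pullback fun x => Ad ϱ (φ x)) {0}ᶜ ↔ ContDiffOn ℝ ∞ (gaugeMat ϱ φ) {0}ᶜ := by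
  constructor
  · intro h
    exact contDiffOn_clm_comp (hsRepL R) h
  · intro h
    rw [pullback_eq_hsRepInvL]
    exact contDiffOn_clm_comp (hsRepInvL R) h

theorem contDiffOn_inverse {M : Type*} [NormedRing M] [NormedAlgebra ℂ M] [CompleteSpace M]
    {f g : C2 → M} (hf : ContDiffOn ℝ ∞ f {0}ᶜ) (h1 : ∀ z, z ≠ 0 → f z * g z = 1)
    (h2 : ∀ z, z ≠ 0 → g z * f z = 1) : ContDiffOn ℝ ∞ g {0}ᶜ := by
  have h : ContDiffOn ℝ ∞ (fun z => Ring.inverse (f z)) {0}ᶜ := by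
    intro z hz
    have := contDiffAt_ringInverse (n := ∞) ℝ (⟨f z, g z, h1 z hz, h2 z hz⟩ : Mˣ)
    exact (this.comp z (contDiffAt_of_punctured hf hz)).contDiffWithinAt
  refine h.congr fun z hz => ?_
  exact (Ring.inverse_unit (⟨f z, g z, h1 z hz, h2 z hz⟩ : Mˣ)).symm

theorem contDiffOn_star {M : Type*} [NormedRing M] [NormedAlgebra ℂ M] [StarRing M]
    [StarModule ℂ M] [NormedStarGroup M] {f : C2 → M} (hf : ContDiffOn ℝ ∞ f {0}ᶜ) :
    ContDiffOn ℝ ∞ (fun z => star (f z)) {0}ᶜ :=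
  ((starL' ℝ : M ≃L[ℝ] M) : M →L[ℝ] M).contDiff.comp_contDiffOn hf

theorem contDiffOn_gaugeMat_inv {φ : CP1 → PFc ϱ} (h : ContDiffOn ℝ ∞ (gaugeMat ϱ φ) {0}ᶜ) :
    ContDiffOn ℝ ∞ (gaugeMat ϱ fun x => (φ x)⁻¹) {0}ᶜ :=
  contDiffOn_inverse h (fun _ hz => gaugeMat_mul_inv φ hz) fun _ hz => gaugeMat_inv_mul φ hz

theorem contDiffOn_gaugeMat_starInv_inv {φ : CP1 → PFc ϱ}
    (h : ContDiffOn ℝ ∞ (gaugeMat ϱ φ) {0}ᶜ) :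
    ContDiffOn ℝ ∞ (gaugeMat ϱ fun x => (starInv ϱ (φ x))⁻¹) {0}ᶜ :=
  (contDiffOn_star h).congr fun _ hz => gaugeMat_starInv_inv φ hz

theorem contDiffOn_gaugeMat_starInv {φ : CP1 → PFc ϱ}
    (h : ContDiffOn ℝ ∞ (gaugeMat ϱ φ) {0}ᶜ) :
    ContDiffOn ℝ ∞ (gaugeMat ϱ fun x => starInv ϱ (φ x)) {0}ᶜ := by
  simpa using contDiffOn_gaugeMat_inv (contDiffOn_gaugeMat_starInv_inv h)

theorem ComplexGauge.contDiffOn_gaugeMat (κ : ComplexGauge ϱ) :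
    ContDiffOn ℝ ∞ (gaugeMat ϱ κ.toFun) {0}ᶜ :=
  (contDiffOn_pullback_iff _).1 κ.smooth

theorem hsRepL_mul (S T : (R →L[ℂ] R) →L[ℂ] (R →L[ℂ] R)) :
    hsRepL R (S * T) = hsRepL R S * hsRepL R T := map_mul (hsRep R) S T

theorem hsRepL_del_pullback {φ : CP1 → PFc ϱ} (h : ContDiffOn ℝ ∞ (gaugeMat ϱ φ) {0}ᶜ) {z : C2}
    (hz : z ≠ 0) (v : C2) : hsRepL R (del (pullback fun x => Ad ϱ (φ x)) z v)
      = del (gaugeMat ϱ φ) z v :=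
  (del_clm_comp (hsRepL R)
    (differentiableAt_of_punctured ((contDiffOn_pullback_iff φ).2 h) hz)).symm

theorem hsRepL_delbar_pullback {φ : CP1 → PFc ϱ} (h : ContDiffOn ℝ ∞ (gaugeMat ϱ φ) {0}ᶜ) {z : C2}
    (hz : z ≠ 0) (v : C2) : hsRepL R (delbar (pullback fun x => Ad ϱ (φ x)) z v)
      = delbar (gaugeMat ϱ φ) z v :=
  (delbar_clm_comp (hsRepL R)
    (differentiableAt_of_punctured ((contDiffOn_pullback_iff φ).2 h) hz)).symm

theorem hsRepL_fderiv_pullback {φ : CP1 → PFc ϱ} (h : ContDiffOn ℝ ∞ (gaugeMat ϱ φ) {0}ᶜ) {z : C2}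
    (hz : z ≠ 0) (v : C2) : hsRepL R (fderiv ℝ (pullback fun x => Ad ϱ (φ x)) z v)
      = fderiv ℝ (gaugeMat ϱ φ) z v :=
  (fderiv_clm_comp (hsRepL R)
    (differentiableAt_of_punctured ((contDiffOn_pullback_iff φ).2 h) hz)).symm

/-- The matrix of the `(1,0)`-part of a one-form in the direction `v`. -/
def OneForm.mat10 (B : OneForm R) (v z : C2) : HSMat R := hsRepL R (B.part10 z v)

/-- The matrix of the `(0,1)`-part of a one-form in the direction `v`. -/
def OneForm.mat01 (B : OneForm R) (v z : C2) : HSMat R := hsRepL R (B.part01 z v)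

theorem OneForm.mat10_add_mat01 (B : OneForm R) (v z : C2) :
    B.mat10 v z + B.mat01 v z = hsRepL R (B z v) := by
  rw [OneForm.mat10, OneForm.mat01, ← map_add, B.part10_add_part01]

/-- If `B₂` is the transform of `B₁` by `κ`, then `∂κ^* = κ^* B₁^{1,0} - B₂^{1,0} κ^*`. -/
theorem del_star_gaugeMat_of_actForm (κ : ComplexGauge ϱ) {B₁ B₂ : OneForm R}
    (hB : B₁.IsAdditive) (h : ∀ z : C2, z ≠ 0 → ∀ v : C2, B₂ z v = κ.actForm B₁ z v)
    {z : C2} (hz : z ≠ 0) (v : C2) :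
    del (fun y => star (gaugeMat ϱ κ.toFun y)) z v
      = star (gaugeMat ϱ κ.toFun z) * B₁.mat10 v z - B₂.mat10 v z * star (gaugeMat ϱ κ.toFun z) := by
  have hK := κ.contDiffOn_gaugeMat
  have hS := contDiffOn_gaugeMat_starInv hK
  set S := gaugeMat ϱ fun x => starInv ϱ (κ.toFun x) with hSdef
  have hST : ∀ y, y ≠ 0 → S y * star (gaugeMat ϱ κ.toFun y) = 1 := fun y hy => by
    rw [← gaugeMat_starInv_inv _ hy, gaugeMat_mul_inv _ hy]
  have hTS : ∀ y, y ≠ 0 → star (gaugeMat ϱ κ.toFun y) * S y = 1 := fun y hy => by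
    rw [← gaugeMat_starInv_inv _ hy]; exact gaugeMat_inv_mul _ hy
  have e : B₂.mat10 v z = star (gaugeMat ϱ κ.toFun z) * (del S z v + B₁.mat10 v z * S z) := by
    have : B₂.part10 z v = (κ.actForm B₁).part10 z v := by
      simp only [OneForm.part10, h z hz]
    rw [OneForm.mat10, this, κ.part10_actForm hB hz, hsRepL_mul, map_add, hsRepL_mul,
      hsRepL_del_pullback hS hz, ← gaugeMat_starInv_inv _ hz]
    rfl
  -- Differentiating `κ^* κ^{*-1} = 1` trades the derivative of `κ^{*-1}` for that of `κ^*`.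
  have d : del (fun y => star (gaugeMat ϱ κ.toFun y)) z v * S z
      + star (gaugeMat ϱ κ.toFun z) * del S z v = 0 := by
    rw [← del_mul (differentiableAt_of_punctured (contDiffOn_star hK) hz)
      (differentiableAt_of_punctured hS hz), del_congr (g := fun _ => (1 : HSMat R)) hTS hz]
    simp [del]
  have d' : star (gaugeMat ϱ κ.toFun z) * del S z v
      = -(del (fun y => star (gaugeMat ϱ κ.toFun y)) z v * S z) := eq_neg_of_add_eq_zero_right d
  rw [e, mul_add, d', add_mul, neg_mul, mul_assoc, hST z hz, mul_one, mul_assoc, mul_assoc,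
    hST z hz, mul_one]
  abel

/-- If `B₂` is the transform of `B₁` by `κ`, then `∂̄κ = κ B₂^{0,1} - B₁^{0,1} κ`. -/
theorem delbar_gaugeMat_of_actForm (κ : ComplexGauge ϱ) {B₁ B₂ : OneForm R}
    (hB : B₁.IsAdditive) (h : ∀ z : C2, z ≠ 0 → ∀ v : C2, B₂ z v = κ.actForm B₁ z v)
    {z : C2} (hz : z ≠ 0) (v : C2) :
    delbar (gaugeMat ϱ κ.toFun) z v
      = gaugeMat ϱ κ.toFun z * B₂.mat01 v z - B₁.mat01 v z * gaugeMat ϱ κ.toFun z := by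
  have hK := κ.contDiffOn_gaugeMat
  have e : B₂.mat01 v z = gaugeMat ϱ (fun x => (κ.toFun x)⁻¹) z
      * (delbar (gaugeMat ϱ κ.toFun) z v + B₁.mat01 v z * gaugeMat ϱ κ.toFun z) := by
    have : B₂.part01 z v = (κ.actForm B₁).part01 z v := by
      simp only [OneForm.part01, h z hz]
    rw [OneForm.mat01, this, κ.part01_actForm hB hz, hsRepL_mul, map_add, hsRepL_mul,
      hsRepL_delbar_pullback hK hz]
    rfl
  rw [e, ← mul_assoc, gaugeMat_mul_inv _ hz, one_mul]
  abel

theorem mat10_zero (v z : C2) : (0 : OneForm R).mat10 v z = 0 := by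
  simp [OneForm.mat10, OneForm.part10]

theorem mat01_zero (v z : C2) : (0 : OneForm R).mat01 v z = 0 := by
  simp [OneForm.mat01, OneForm.part01]

/-- The connections of `𝒜^F` are unitary. -/
theorem Configuration.star_mat01 (x : Configuration ϱ) {z : C2} (hz : z ≠ 0) (v : C2) :
    star (x.B.mat01 v z) = -x.B.mat10 v z := by
  obtain ⟨κ, h⟩ := x.mem
  -- For a transform of the zero form, `∂κ^* = (∂̄κ)^*` compares the two types of `B` after
  -- multiplication by the invertible `κ^*`, which is cancelled at the end.
  have h1 := del_star_gaugeMat_of_actForm κ isAdditive_zero h hz v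
  have h2 := delbar_gaugeMat_of_actForm κ isAdditive_zero h hz v
  rw [del_star (differentiableAt_of_punctured κ.contDiffOn_gaugeMat hz), h2, mat01_zero,
    mat10_zero, zero_mul, mul_zero, sub_zero, zero_sub, star_mul, ← neg_mul] at h1
  have h3 : star (gaugeMat ϱ κ.toFun z) * star (gaugeMat ϱ (fun x => (κ.toFun x)⁻¹) z) = 1 := by
    rw [← star_mul, gaugeMat_inv_mul _ hz, star_one]
  calc _ = star (x.B.mat01 v z) * (star (gaugeMat ϱ κ.toFun z)
        * star (gaugeMat ϱ (fun x => (κ.toFun x)⁻¹) z)) := by rw [h3, mul_one]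
    _ = _ := by rw [← mul_assoc, h1, mul_assoc, h3, mul_one]

theorem Configuration.contDiffOn_mat01 (x : Configuration ϱ) (v : C2) :
    ContDiffOn ℝ ∞ (x.B.mat01 v) {0}ᶜ := by
  obtain ⟨κ, h⟩ := x.mem
  have hK := κ.contDiffOn_gaugeMat
  refine ((contDiffOn_gaugeMat_inv hK).mul (contDiffOn_delbar hK v)).congr fun z hz => ?_
  rw [delbar_gaugeMat_of_actForm κ isAdditive_zero h hz v, mat01_zero, zero_mul, sub_zero,
    ← mul_assoc, gaugeMat_inv_mul _ hz, one_mul]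

theorem Configuration.contDiffOn_mat10 (x : Configuration ϱ) (v : C2) :
    ContDiffOn ℝ ∞ (x.B.mat10 v) {0}ᶜ := by
  refine (contDiffOn_star (x.contDiffOn_mat01 v)).neg.congr fun z hz => ?_
  rw [x.star_mat01 hz, neg_neg]

/-- The matrix of the curvature on the pair `(v, i v)`. -/
theorem Configuration.hsRepL_curvature (x : Configuration ϱ) {z : C2} (hz : z ≠ 0) (v : C2) :
    hsRepL R (curvature x.B z v (Complex.I • v))
      = (-2 * Complex.I) • curvatureCoeff v (x.B.mat10 v) (x.B.mat01 v) z := by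
  have ha := x.contDiffOn_mat10 v
  have hb := x.contDiffOn_mat01 v
  have da := differentiableAt_of_punctured ha hz
  have db := differentiableAt_of_punctured hb hz
  have e1 : ∀ y, hsRepL R (x.B y v) = x.B.mat10 v y + x.B.mat01 v y := fun y =>
    (x.B.mat10_add_mat01 v y).symm
  -- On `v` and `i v` the form is `a + b` and `i (a - b)`; expanding the curvature in `a` and `b`
  -- produces the factor `-2i`.
  have e2 : ∀ y, hsRepL R (x.B y (Complex.I • v))
      = Complex.I • (x.B.mat10 v y - x.B.mat01 v y) := by
    intro y
    rw [OneForm.mat10, OneForm.mat01, ← map_sub, ← map_smul]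
    congr 1
    simp only [OneForm.part10, OneForm.part01, ← smul_sub]
    have : x.B y v - Complex.I • x.B y (Complex.I • v)
        - (x.B y v + Complex.I • x.B y (Complex.I • v))
        = (-2 * Complex.I) • x.B y (Complex.I • v) := by module
    rw [this, smul_smul, smul_smul]
    have : Complex.I * 2⁻¹ * (-2 * Complex.I) = 1 := by
      linear_combination (-1 : ℂ) * Complex.I_mul_I
    rw [this, one_smul]
  have inv : ∀ (w y : C2), x.B y w = hsRepInvL R (hsRepL R (x.B y w)) := fun w y => by
    rw [hsRepL_apply, hsRepInvL_apply, AlgEquiv.symm_apply_apply]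
  have d1 : DifferentiableAt ℝ (fun y => x.B y v) z := by
    have : (fun y => x.B y v) = fun y => hsRepInvL R (x.B.mat10 v y + x.B.mat01 v y) := by
      funext y; rw [← e1, ← inv]
    rw [this]
    exact differentiableAt_clm_comp (hsRepInvL R) (da.add db)
  have d2 : DifferentiableAt ℝ (fun y => x.B y (Complex.I • v)) z := by
    have : (fun y => x.B y (Complex.I • v))
        = fun y => hsRepInvL R (Complex.I • (x.B.mat10 v y - x.B.mat01 v y)) := by
      funext y; rw [← e2, ← inv]
    rw [this]
    exact differentiableAt_clm_comp (hsRepInvL R) ((da.sub db).const_smul Complex.I)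
  have f1 : hsRepL R (fderiv ℝ (fun y => x.B y (Complex.I • v)) z v)
      = Complex.I • (fderiv ℝ (x.B.mat10 v) z v - fderiv ℝ (x.B.mat01 v) z v) := by
    rw [← fderiv_clm_comp (hsRepL R) d2]
    simp only [e2]
    exact congrArg (fun A => A v)
      ((da.hasFDerivAt.sub db.hasFDerivAt).const_smul Complex.I).fderiv
  have f2 : hsRepL R (fderiv ℝ (fun y => x.B y v) z (Complex.I • v))
      = fderiv ℝ (x.B.mat10 v) z (Complex.I • v) + fderiv ℝ (x.B.mat01 v) z (Complex.I • v) := by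
    rw [← fderiv_clm_comp (hsRepL R) d1]
    simp only [e1]
    exact congrArg (fun A => A (Complex.I • v)) (da.hasFDerivAt.add db.hasFDerivAt).fderiv
  rw [curvature, map_add, map_sub, map_sub, hsRepL_mul, hsRepL_mul, f1, f2, e1, e2]
  simp only [curvatureCoeff, del, delbar, mul_smul_comm, smul_mul_assoc, smul_sub, smul_add,
    smul_smul, mul_add, add_mul, mul_sub, sub_mul]
  have i1 : -2 * Complex.I * 2⁻¹ = -Complex.I := by ring
  have i2 : -2 * Complex.I * (2⁻¹ * Complex.I) = 1 := by
    linear_combination (-1 : ℂ) * Complex.I_mul_I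
  rw [i1, i2]
  module

end Gauge

/-! ### Positivity of the Fubini–Study form, bounds, and directions transverse to the Hopf fibres -/

theorem fubiniStudy_I_smul (z v : C2) :
    fubiniStudy z v (Complex.I • v) = (‖v‖ ^ 2 * ‖z‖ ^ 2 - ‖inner ℂ z v‖ ^ 2) / ‖z‖ ^ 4 := by
  have h1 : inner ℂ v (Complex.I • v) = Complex.I * ((‖v‖ : ℂ) ^ 2) := by
    rw [inner_smul_right, inner_self_eq_norm_sq_to_K]; rfl
  have h2 : inner ℂ v z * inner ℂ z (Complex.I • v)
      = Complex.I * ((‖inner ℂ z v‖ : ℂ) ^ 2) := by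
    have h3 : (‖inner ℂ z v‖ : ℂ) ^ 2 = inner ℂ v z * inner ℂ z v := by
      rw [← inner_conj_symm v z, RCLike.conj_mul]; rfl
    rw [inner_smul_right, h3]
    ring
  rw [fubiniStudy, h1, h2]
  have h4 : (Complex.I * (‖v‖ : ℂ) ^ 2 * (‖z‖ : ℂ) ^ 2 - Complex.I * (‖inner ℂ z v‖ : ℂ) ^ 2)
      / (‖z‖ : ℂ) ^ 4
      = Complex.I * (((‖v‖ ^ 2 * ‖z‖ ^ 2 - ‖inner ℂ z v‖ ^ 2) / ‖z‖ ^ 4 : ℝ) : ℂ) := by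
    push_cast
    ring
  rw [h4, Complex.I_mul_im, Complex.ofReal_re]

theorem fubiniStudy_I_smul_nonneg (z v : C2) : 0 ≤ fubiniStudy z v (Complex.I • v) := by
  rw [fubiniStudy_I_smul]
  apply div_nonneg _ (by positivity)
  have := norm_inner_le_norm (𝕜 := ℂ) z v
  have := pow_le_pow_left₀ (norm_nonneg _) this 2
  rw [mul_pow] at this
  linarith

/-- The numerator is the defect in the Cauchy–Schwarz inequality, which vanishes only for dependent
vectors. -/
theorem fubiniStudy_I_smul_pos {z v : C2} (h : LinearIndependent ℂ ![z, v]) :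
    0 < fubiniStudy z v (Complex.I • v) := by
  have hz : z ≠ 0 := h.ne_zero 0
  have hv : v ≠ 0 := h.ne_zero 1
  refine lt_of_le_of_ne (fubiniStudy_I_smul_nonneg z v) fun h0 => ?_
  rw [fubiniStudy_I_smul] at h0
  have hz' : ‖z‖ ^ 4 ≠ 0 := pow_ne_zero _ (norm_ne_zero_iff.2 hz)
  have h1 : ‖v‖ ^ 2 * ‖z‖ ^ 2 - ‖inner ℂ z v‖ ^ 2 = 0 := by
    rcases div_eq_zero_iff.1 h0.symm with h | h
    · exact h
    · exact absurd h hz'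
  have h2 : ‖inner ℂ z v‖ = ‖z‖ * ‖v‖ := by
    have : ‖inner ℂ z v‖ ^ 2 = (‖z‖ * ‖v‖) ^ 2 := by rw [mul_pow]; linarith
    exact (pow_left_inj₀ (norm_nonneg _) (by positivity) two_ne_zero).1 this
  obtain ⟨r, -, hr⟩ := (norm_inner_eq_norm_iff hz hv).1 h2
  have := LinearIndependent.pair_iff.1 h r (-1) (by rw [hr]; module)
  norm_num at this

/-- A continuous function on `ℂ² ∖ {0}` that comes from `ℂP¹` is bounded. -/
theorem exists_bound_of_projective {u : C2 → ℝ} (hu : ContinuousOn u {0}ᶜ)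
    (h : ∀ z : C2, z ≠ 0 → ∀ c : ℂ, c ≠ 0 → u (c • z) = u z) :
    ∃ C, ∀ z, z ≠ 0 → |u z| ≤ C := by
  obtain ⟨C, hC⟩ := (isCompact_sphere (0 : C2) 1).bddAbove_image (f := fun z => |u z|)
    ((hu.mono fun z hz => by
      rintro rfl
      simp at hz).abs)
  refine ⟨C, fun z hz => ?_⟩
  have hn : ‖z‖ ≠ 0 := norm_ne_zero_iff.2 hz
  rw [← h z hz ((‖z‖⁻¹ : ℝ) : ℂ) (by simpa using hz)]
  exact hC ⟨_, by simp [norm_smul, hn], rfl⟩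

theorem exists_linearIndependent_pair {z : C2} (hz : z ≠ 0) :
    ∃ w, LinearIndependent ℂ ![z, w] := by
  by_contra! hcon
  have h : ∀ w : C2, ∃ c : ℂ, c • z = w := by
    intro w
    by_contra! hw
    exact hcon w ((LinearIndependent.pair_iff' hz).2 hw)
  have : Module.finrank ℂ C2 ≤ 1 := finrank_le_one z h
  simp at this

/-- An additive identity on `ℂ²` that holds on the complement of a line holds everywhere. -/
theorem eq_zero_of_linearIndependent {W : Type*} [AddGroup W] {F : C2 → W}
    (hF : ∀ v w, F (v + w) = F v + F w) {z : C2} (hz : z ≠ 0)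
    (h : ∀ v, LinearIndependent ℂ ![z, v] → F v = 0) (v : C2) : F v = 0 := by
  by_cases hv : LinearIndependent ℂ ![z, v]
  · exact h v hv
  · obtain ⟨w, hw⟩ := exists_linearIndependent_pair hz
    have hc : ∃ c : ℂ, c • z = v := by
      by_contra! hc
      exact hv ((LinearIndependent.pair_iff' hz).2 hc)
    obtain ⟨c, rfl⟩ := hc
    -- A multiple of `z` is the difference of `c • z + w` and `w`, both independent of `z`.
    have hw2 : LinearIndependent ℂ ![z, c • z + w] := by
      rw [LinearIndependent.pair_iff] at hw ⊢
      intro s t hst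
      have := hw (s + t * c) t (by rw [← hst]; module)
      refine ⟨?_, this.2⟩
      simpa [this.2] using this.1
    have := hF (c • z) w
    rw [h _ hw2, h _ hw, add_zero] at this
    exact this.symm

/-! ### Vanishing of the squares in the Laplacian of `tr (κ κ^*)` -/

section Rigidity

open scoped Matrix.Norms.L2Operator

variable {Γ : Subgroup SU2} {R : Type*} [NormedAddCommGroup R] [InnerProductSpace ℂ R]
  [CompleteSpace R] [FiniteDimensional ℂ R] {ϱ : Γ →* unitary (R →L[ℂ] R)}

/-- The moment map equation is evaluated on `(v, i v)` and multiplied by `i / 2`, the inverse of the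
factor `-2i` relating curvature and its coefficient. -/
theorem Configuration.MomentMap.curvatureCoeff_eq [Fintype Γ] {x : Configuration ϱ} {c : ℝ}
    {ζ : R →L[ℂ] R} (h : x.MomentMap c ζ) {z : C2} (hz : z ≠ 0) (v : C2) {μ : ℝ}
    (hμ : μ = c * fubiniStudy z v (Complex.I • v)) :
    curvatureCoeff v (x.B.mat10 v) (x.B.mat01 v) z
      = hsRep R ((Complex.I * μ / 2) • ad ζ - (μ / 4 : ℂ) •
        ad (average ϱ (x.Θ.toFun (toS3 z hz) * star (x.Θ.toFun (toS3 z hz))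
            - star (x.Θ.toFun (toS3 z hz)) * x.Θ.toFun (toS3 z hz)))) := by
  have h1 := congrArg (hsRepL R) (h z hz v (Complex.I • v))
  rw [← hμ, map_sub, x.hsRepL_curvature hz, map_smul, map_smul, sub_eq_iff_eq_add] at h1
  have h2 := congrArg (fun A => (Complex.I / 2) • A) h1
  simp only [smul_add, smul_smul] at h2
  have i1 : Complex.I / 2 * (-2 * Complex.I) = 1 := by
    linear_combination (-1 : ℂ) * Complex.I_mul_I
  have i2 : Complex.I / 2 * (Complex.I / 2 * (μ : ℂ)) = -(μ / 4 : ℂ) := by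
    linear_combination (μ / 4 : ℂ) * Complex.I_mul_I
  have i3 : Complex.I / 2 * (μ : ℂ) = Complex.I * μ / 2 := by ring
  rw [i1, one_smul, i2, i3, neg_smul, ← sub_eq_add_neg] at h2
  rw [h2, map_sub, map_smul, map_smul]
  rfl

theorem gaugeMat_smul (φ : CP1 → PFc ϱ) {z : C2} (hz : z ≠ 0) {c : ℂ} (hc : c ≠ 0) :
    gaugeMat ϱ φ (c • z) = gaugeMat ϱ φ z := by
  rw [gaugeMat_of_ne φ hz, gaugeMat_of_ne φ (smul_ne_zero hc hz)]
  congr 2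
  exact (Projectivization.mk_eq_mk_iff' ℂ _ _ _ _).2 ⟨c, rfl⟩

/-- A complex gauge transformation between two solutions is covariantly constant in the antilinear
sense, and it intertwines the sections in the adjoint sense. -/
theorem rigidity [Fintype Γ] {c : ℝ} (hc : 0 < c) {ζ : R →L[ℂ] R} (hζ : ζ ∈ centre ϱ)
    {x₁ x₂ : Configuration ϱ} (mom₁ : x₁.MomentMap c ζ) (mom₂ : x₂.MomentMap c ζ)
    {κ : ComplexGauge ϱ} (h : ComplexRelated κ x₁ x₂) {z : C2} (hz : z ≠ 0) :
    (∀ v, delbar (fun y => star (gaugeMat ϱ κ.toFun y)) z v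
      = star (gaugeMat ϱ κ.toFun z) * x₁.B.mat01 v z
        - x₂.B.mat01 v z * star (gaugeMat ϱ κ.toFun z)) ∧
    ∀ f : Fc ϱ, (f : PFc ϱ) = κ.toFun (Projectivization.mk ℂ z hz) →
      star ((f : (R →L[ℂ] R)ˣ) : R →L[ℂ] R) * x₁.Θ.toFun (toS3 z hz)
        = x₂.Θ.toFun (toS3 z hz) * star ((f : (R →L[ℂ] R)ˣ) : R →L[ℂ] R) := by
  set K := gaugeMat ϱ κ.toFun with hKdef
  have hK : ContDiffOn ℝ ∞ K {0}ᶜ := κ.contDiffOn_gaugeMat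
  have hT : ContDiffOn ℝ ∞ (fun y => star (K y)) {0}ᶜ := contDiffOn_star hK
  have hAdd := x₁.isAdditive
  have hAdd₂ := x₂.isAdditive
  set τ := traceL (Idx R × Idx R) with hτ
  set g : C2 → ℂ := fun y => τ (K y * star (K y)) with hg
  have hgs : ContDiffOn ℝ ∞ g {0}ᶜ := contDiffOn_clm_comp τ (hK.mul hT)
  set u : C2 → ℝ := fun y => Complex.reCLM (g y) with hu
  have hus : ContDiffOn ℝ ∞ u {0}ᶜ := Complex.reCLM.contDiff.comp_contDiffOn hgs
  -- The covariant `∂̄` derivative of `κ^*`, the only half not already killed by the complex orbit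
  -- relation.
  set Y : C2 → C2 → HSMat R := fun y v => delbar (fun y => star (K y)) y v
    + x₂.B.mat01 v y * star (K y) - star (K y) * x₁.B.mat01 v y with hY
  have hfib : ∀ (y : C2) (hy : y ≠ 0) (f : Fc ϱ),
      (f : PFc ϱ) = κ.toFun (Projectivization.mk ℂ y hy) →
      x₁.Θ.toFun (toS3 y hy) * ((f : (R →L[ℂ] R)ˣ) : R →L[ℂ] R)
        = ((f : (R →L[ℂ] R)ˣ) : R →L[ℂ] R) * x₂.Θ.toFun (toS3 y hy) := by
    intro y hy f hf
    have h2 := h.2 y hy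
    rw [← hf] at h2
    have h3 : Ad ϱ (f : PFc ϱ) (x₂.Θ.toFun (toS3 y hy))
        = ((f : (R →L[ℂ] R)ˣ) : R →L[ℂ] R) * x₂.Θ.toFun (toS3 y hy)
          * ((f⁻¹ : (R →L[ℂ] R)ˣ) : R →L[ℂ] R) := rfl
    rw [h2, h3, mul_assoc, Units.inv_mul, mul_one]
  have lap : ∀ (y : C2) (hy : y ≠ 0) (f : Fc ϱ),
      (f : PFc ϱ) = κ.toFun (Projectivization.mk ℂ y hy) →
      ∃ N : ℝ, 0 ≤ N ∧ (N = 0 → star ((f : (R →L[ℂ] R)ˣ) : R →L[ℂ] R) * x₁.Θ.toFun (toS3 y hy)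
        = x₂.Θ.toFun (toS3 y hy) * star ((f : (R →L[ℂ] R)ˣ) : R →L[ℂ] R)) ∧
      ∀ v, lineLaplacian u y v = 4 * (Matrix.trace (star (Y y v) * Y y v)).re
        + c * fubiniStudy y v (Complex.I • v) * N := by
    intro y hy f hf
    obtain ⟨N, hN, hN0, hvar⟩ := exists_moment_variation ϱ hζ f (hfib y hy f hf)
    refine ⟨N, hN, hN0, fun v => ?_⟩
    have e1 := del_delbar_trace τ traceL_mul_comm v hK hT (x₁.contDiffOn_mat10 v)
      (x₁.contDiffOn_mat01 v) (x₂.contDiffOn_mat10 v) (x₂.contDiffOn_mat01 v)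
      (fun w hw => del_star_gaugeMat_of_actForm κ hAdd h.1 hw v)
      (fun w hw => delbar_gaugeMat_of_actForm κ hAdd h.1 hw v) hy
    have hKf : K y = hsRep R (ContinuousLinearMap.mulLeftRight ℂ (R →L[ℂ] R)
        ((f : (R →L[ℂ] R)ˣ) : R →L[ℂ] R) ((f⁻¹ : (R →L[ℂ] R)ˣ) : R →L[ℂ] R)) := by
      rw [hKdef, gaugeMat_of_ne _ hy, ← hf, gaugeRep_mk]
    -- Both connections are unitary, so the covariant `∂` derivative of `κ` is the adjoint of `Y`
    -- and their product is a square.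
    have hX : del K y v + x₁.B.mat10 v y * K y - K y * x₂.B.mat10 v y = star (Y y v) := by
      simp only [hY]
      rw [delbar_star (differentiableAt_of_punctured hK hy), star_sub, star_add, star_star,
        star_mul, star_mul, star_star, x₁.star_mat01 hy, x₂.star_mat01 hy]
      noncomm_ring
    rw [mom₁.curvatureCoeff_eq hy v rfl, mom₂.curvatureCoeff_eq hy v rfl, hX, add_sub_assoc,
      hτ, traceL_apply, traceL_apply, traceL_apply, hvar _ (K y) (star (K y)) hKf rfl] at e1
    rw [del_delbar hgs hy] at e1
    have e2 : lineLaplacian u y v = (lineLaplacian g y v).re :=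
      lineLaplacian_clm_comp Complex.reCLM hgs hy v
    have e3 : lineLaplacian g y v = 4 * ((4⁻¹ : ℂ) • lineLaplacian g y v) := by
      rw [smul_eq_mul]; ring
    rw [e2, e3, e1]
    have e4 : (4 : ℂ) = ((4 : ℝ) : ℂ) := by norm_num
    rw [e4, Complex.re_ofReal_mul, Complex.add_re, Complex.ofReal_re]
    ring
  have hsub : ∀ y, y ≠ 0 → ∀ v, 0 ≤ lineLaplacian u y v := by
    intro y hy v
    obtain ⟨f, hf⟩ := QuotientGroup.mk_surjective (κ.toFun (Projectivization.mk ℂ y hy))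
    obtain ⟨N, hN, -, hl⟩ := lap y hy f hf
    rw [hl]
    have := trace_star_mul_self_re_nonneg (Y y v)
    have := mul_nonneg (mul_nonneg hc.le (fubiniStudy_I_smul_nonneg y v)) hN
    linarith
  obtain ⟨C, hC⟩ := exists_bound_of_projective hus.continuousOn fun y hy b hb => by
    simp only [hu, hg, hKdef, gaugeMat_smul _ hy hb]
  have hzero : ∀ v, LinearIndependent ℂ ![z, v] → lineLaplacian u z v = 0 := fun v hv =>
    lineLaplacian_eq_zero_of_bounded hus hC hsub hv
  constructor
  · intro v
    have hYv : Y z v = 0 := by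
      -- Rigidity only sees directions independent of `z`; additivity extends it to the radial ones.
      refine eq_zero_of_linearIndependent (F := Y z) (fun v w => ?_) hz (fun v hv => ?_) v
      · simp only [hY, OneForm.mat01, delbar_add_right, hAdd.part01_add hz, hAdd₂.part01_add hz,
          map_add]
        noncomm_ring
      · obtain ⟨f, hf⟩ := QuotientGroup.mk_surjective (κ.toFun (Projectivization.mk ℂ z hz))
        obtain ⟨N, hN, -, hl⟩ := lap z hz f hf
        have h0 := hzero v hv
        rw [hl] at h0
        have h1 := trace_star_mul_self_re_nonneg (Y z v)
        have h2 := mul_nonneg (mul_nonneg hc.le (fubiniStudy_I_smul_nonneg z v)) hN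
        exact eq_zero_of_trace_star_mul_self_re (by linarith)
    have : delbar (fun y => star (K y)) z v = Y z v
        + (star (K z) * x₁.B.mat01 v z - x₂.B.mat01 v z * star (K z)) := by
      simp only [hY]; abel
    rw [this, hYv, zero_add]
  · intro f hf
    obtain ⟨N, hN, hN0, hl⟩ := lap z hz f hf
    apply hN0
    -- A transverse direction is needed for the coefficient of `N` to be strictly positive.
    obtain ⟨v, hv⟩ := exists_linearIndependent_pair hz
    have h0 := hzero v hv
    rw [hl] at h0
    have h1 := trace_star_mul_self_re_nonneg (Y z v)
    have h2 := mul_pos hc (fubiniStudy_I_smul_pos hv)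
    have h3 := mul_nonneg h2.le hN
    have h4 : c * fubiniStudy z v (Complex.I • v) * N = 0 := by linarith
    exact (mul_eq_zero.1 h4).resolve_left h2.ne'

end Rigidity

/-! ## Polynomials in a covariantly constant endomorphism -/

section Polynomial

open Polynomial

variable {M : Type*} [CStarAlgebra M]

theorem eval_eq_zero_of_mem_spectrum {H : M} {m : ℝ[X]} (hm : aeval H m = 0) {r : ℝ}
    (hr : r ∈ spectrum ℝ H) : m.eval r = 0 := by
  by_contra hne
  have h := spectrum.subset_polynomial_aeval H m ⟨r, hr, rfl⟩
  rw [hm, spectrum.mem_iff, sub_zero] at h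
  exact h ((IsUnit.mk0 _ hne).map (algebraMap ℝ M))

/-- A positive square root is the value of any polynomial that interpolates the square root on the
roots of an annihilating polynomial. -/
theorem aeval_eq_of_interpolates_sqrt {G H : M} (hG : star G = G) (hH : G * G * (G * G) = H)
    {m q : ℝ[X]} (hm : aeval H m = 0) (hq : ∀ r, m.eval r = 0 → q.eval r = √r) :
    aeval H q = G * G := by
  have hsa : IsSelfAdjoint (G * G) := by
    rw [isSelfAdjoint_iff, star_mul, hG]
  have hH' : aeval (G * G) (X ^ 2 : ℝ[X]) = H := by
    rw [map_pow, aeval_X, pow_two, hH]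
  have h0 : aeval (G * G) (q.comp (X ^ 2) - X : ℝ[X]) = 0 := by
    -- It suffices that `q (r ^ 2) = r` on the spectrum of `G * G`. There `r ≥ 0` because `G` is
    -- selfadjoint, and `r ^ 2`, lying in the spectrum of `H`, is a root of `m`.
    rw [← cfc_polynomial (q.comp (X ^ 2) - X : ℝ[X]) (G * G) hsa,
      ← cfc_const_zero ℝ (G * G)]
    refine cfc_congr fun r hr => ?_
    have hr0 : 0 ≤ r := by
      have := spectrum_star_mul_self_nonneg (b := G) r
      rw [hG] at this
      exact this hr
    have hr2 : r ^ 2 ∈ spectrum ℝ H := by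
      have := spectrum.subset_polynomial_aeval (G * G) (X ^ 2 : ℝ[X]) ⟨r, hr, rfl⟩
      rw [hH'] at this
      simpa using this
    have := hq _ (eval_eq_zero_of_mem_spectrum hm hr2)
    rw [Real.sqrt_sq hr0] at this
    simp [this]
  rw [map_sub, aeval_comp, hH', aeval_X, sub_eq_zero] at h0
  exact h0

/-- Commutation with `b` is a derivation, so parallel endomorphisms form an algebra and polynomials
in one are parallel. -/
theorem fderiv_aeval_of_commutator {H : C2 → M} {z v : C2} {b : M} (hd : DifferentiableAt ℝ H z)
    (h : fderiv ℝ H z v = H z * b - b * H z) (p : ℝ[X]) :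
    DifferentiableAt ℝ (fun y => aeval (H y) p) z ∧
      fderiv ℝ (fun y => aeval (H y) p) z v = aeval (H z) p * b - b * aeval (H z) p := by
  induction p using Polynomial.induction_on with
  | C r =>
    simp only [aeval_C]
    refine ⟨differentiableAt_const _, ?_⟩
    rw [Algebra.commutes]
    simp
  | add p q hp hq =>
    simp only [map_add]
    refine ⟨hp.1.add hq.1, ?_⟩
    rw [fderiv_fun_add hp.1 hq.1, add_apply, hp.2, hq.2]
    noncomm_ring
  | monomial n r hn =>
    have e : ∀ y, aeval (H y) (C r * X ^ (n + 1)) = aeval (H y) (C r * X ^ n) * H y := by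
      intro y
      simp only [map_mul, map_pow, aeval_X, pow_succ, mul_assoc]
    simp only [e]
    refine ⟨hn.1.mul hd, ?_⟩
    rw [fderiv_mul_punctured hn.1 hd, hn.2, h]
    noncomm_ring

theorem star_aeval {H : M} (hH : star H = H) (p : ℝ[X]) : star (aeval H p) = aeval H p := by
  induction p using Polynomial.induction_on with
  | C r =>
    rw [aeval_C, Algebra.algebraMap_eq_smul_one, star_smul, star_one, star_trivial]
  | add p q hp hq => rw [map_add, star_add, hp, hq]
  | monomial n r _ =>
    simp only [map_mul, map_pow, aeval_X, aeval_C]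
    rw [star_mul, star_pow, hH, Algebra.algebraMap_eq_smul_one, star_smul, star_one, star_trivial,
      smul_mul_assoc, mul_smul_comm, one_mul, mul_one]

theorem contDiffOn_aeval {H : C2 → M} (hH : ContDiffOn ℝ ∞ H {0}ᶜ) (p : ℝ[X]) :
    ContDiffOn ℝ ∞ (fun y => aeval (H y) p) {0}ᶜ := by
  induction p using Polynomial.induction_on with
  | C r =>
    simp only [aeval_C]
    exact contDiffOn_const
  | add p q hp hq =>
    simp only [map_add]
    exact hp.add hq
  | monomial n r _ =>
    simp only [map_mul, map_pow, aeval_X, aeval_C]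
    exact contDiffOn_const.mul (hH.pow _)

theorem isPreconnected_punctured : IsPreconnected ({0}ᶜ : Set C2) := by
  refine (isConnected_compl_singleton_of_one_lt_rank ?_ 0).isPreconnected
  have : Module.finrank ℝ C2 = 4 := by
    rw [finrank_real_of_complex]
    simp
  have h : 1 < Module.finrank ℝ C2 := by omega
  simpa using Module.lt_rank_of_lt_finrank h

/-- A polynomial that annihilates a covariantly constant selfadjoint endomorphism at one point
annihilates it everywhere. -/
theorem aeval_eq_zero_of_covariantly_constant (τ : M →L[ℂ] ℂ) (hτ : ∀ x y, τ (x * y) = τ (y * x))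
    (hτ0 : ∀ x, τ (star x * x) = 0 → x = 0) {H : C2 → M} {b : C2 → C2 → M}
    (hH : ContDiffOn ℝ ∞ H {0}ᶜ) (hstar : ∀ z, z ≠ 0 → star (H z) = H z)
    (hd : ∀ z, z ≠ 0 → ∀ v, fderiv ℝ H z v = H z * b z v - b z v * H z) {p : ℝ[X]}
    {z₀ : C2} (hz₀ : z₀ ≠ 0) (hp : aeval (H z₀) p = 0) {z : C2} (hz : z ≠ 0) :
    aeval (H z) p = 0 := by
  -- The derivative of `τ (p(H)²)` is the trace of a commutator, so this function is constant; since
  -- `p(H)` is selfadjoint, it is the squared norm of `p(H)`.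
  have hs := contDiffOn_clm_comp τ (contDiffOn_aeval hH (p * p))
  have hconst := isOpen_compl_singleton.is_const_of_fderiv_eq_zero (𝕜 := ℝ)
    isPreconnected_punctured (hs.differentiableOn (by simp)) (fun y hy => by
      ext v
      have hy' : y ≠ 0 := hy
      have h1 := fderiv_aeval_of_commutator (differentiableAt_of_punctured hH hy') (hd y hy' v)
        (p * p)
      rw [fderiv_clm_comp τ h1.1, h1.2, map_sub, hτ, sub_self]
      rfl) (x := z) (y := z₀) hz hz₀
  apply hτ0
  rw [star_aeval (hstar z hz), ← map_mul, hconst, map_mul, hp, mul_zero, map_zero]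

end Polynomial

/-! ## The polar decomposition in `F^c` -/

section Polar

variable {Γ : Subgroup SU2} {R : Type*} [NormedAddCommGroup R] [InnerProductSpace ℂ R]
  [CompleteSpace R] {ϱ : Γ →* unitary (R →L[ℂ] R)}

/-- The square root given by functional calculus commutes with whatever commutes with `a`, in
particular with `Γ`. -/
theorem exists_sqrt_mem_Fc (a : Fc ϱ) (ha : 0 ≤ ((a : (R →L[ℂ] R)ˣ) : R →L[ℂ] R)) :
    ∃ s : Fc ϱ, 0 ≤ ((s : (R →L[ℂ] R)ˣ) : R →L[ℂ] R) ∧ s * s = a ∧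
      ∀ X : R →L[ℂ] R, Commute ((a : (R →L[ℂ] R)ˣ) : R →L[ℂ] R) X →
        Commute ((s : (R →L[ℂ] R)ˣ) : R →L[ℂ] R) X := by
  set A : R →L[ℂ] R := ((a : (R →L[ℂ] R)ˣ) : R →L[ℂ] R) with hA
  have hcomm : ∀ X : R →L[ℂ] R, Commute A X → Commute (CFC.sqrt A) X := fun X hX =>
    hX.cfcₙ_nnreal _
  have hu : IsUnit (CFC.sqrt A) := (CFC.isUnit_sqrt_iff A ha).2 (a : (R →L[ℂ] R)ˣ).isUnit
  obtain ⟨s, hs⟩ := hu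
  have hsF : s ∈ Fc ϱ := fun γ => by
    rw [hs]
    exact hcomm _ (a.2 γ)
  refine ⟨⟨s, hsF⟩, ?_, ?_, ?_⟩
  · change 0 ≤ (s : R →L[ℂ] R)
    rw [hs]
    exact CFC.sqrt_nonneg A
  · ext1
    ext1
    change (s : R →L[ℂ] R) * (s : R →L[ℂ] R) = A
    rw [hs, CFC.sqrt_mul_sqrt_self A ha]
  · intro X hX
    change Commute (s : R →L[ℂ] R) X
    rw [hs]
    exact hcomm X hX

theorem starInvFc_inv_val (f : Fc ϱ) :
    ((((starInvFc ϱ f)⁻¹ : Fc ϱ) : (R →L[ℂ] R)ˣ) : R →L[ℂ] R)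
      = star ((f : (R →L[ℂ] R)ˣ) : R →L[ℂ] R) := by
  simp [starInvFc]

/-- A fourth root of `f f^*` in `F^c`. -/
theorem exists_fourth_root (f : Fc ϱ) :
    ∃ g : Fc ϱ, (starInvFc ϱ g)⁻¹ = g ∧ g * g * (g * g) = f * (starInvFc ϱ f)⁻¹ ∧
      ∀ X : R →L[ℂ] R,
        Commute (((f : (R →L[ℂ] R)ˣ) : R →L[ℂ] R) * star ((f : (R →L[ℂ] R)ˣ) : R →L[ℂ] R)) X →
          Commute ((g : (R →L[ℂ] R)ˣ) : R →L[ℂ] R) X := by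
  have hval : (((f * (starInvFc ϱ f)⁻¹ : Fc ϱ) : (R →L[ℂ] R)ˣ) : R →L[ℂ] R)
      = ((f : (R →L[ℂ] R)ˣ) : R →L[ℂ] R) * star ((f : (R →L[ℂ] R)ˣ) : R →L[ℂ] R) := by
    rw [← starInvFc_inv_val]; rfl
  obtain ⟨s, hs0, hs, hsc⟩ := exists_sqrt_mem_Fc (f * (starInvFc ϱ f)⁻¹) (by
    rw [hval]; exact mul_star_self_nonneg _)
  -- The second root exhibits `Ad s` as the square of the selfadjoint `Ad g`; this is how its
  -- positivity is later fed to `aeval_eq_of_interpolates_sqrt`.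
  obtain ⟨g, hg0, hg, hgc⟩ := exists_sqrt_mem_Fc s hs0
  refine ⟨g, ?_, by rw [hg, hs], fun X hX => hgc X (hsc X (by rw [hval]; exact hX))⟩
  ext1
  ext1
  rw [starInvFc_inv_val]
  exact (IsSelfAdjoint.of_nonneg hg0).star_eq

/-- A representative of a class in `F^c / ℂ^*`. -/
def lift (k : PFc ϱ) : Fc ϱ := Quotient.out k

theorem mk_lift (k : PFc ϱ) : ((lift k : Fc ϱ) : PFc ϱ) = k := QuotientGroup.out_eq' k

/-- The positive fourth root of `f f^*`, where `f` is a representative of `k`. -/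
def quarterRoot (k : PFc ϱ) : Fc ϱ := (exists_fourth_root (lift k)).choose

theorem star_quarterRoot (k : PFc ϱ) : (starInvFc ϱ (quarterRoot k))⁻¹ = quarterRoot k :=
  (exists_fourth_root (lift k)).choose_spec.1

theorem quarterRoot_pow_four (k : PFc ϱ) :
    quarterRoot k * quarterRoot k * (quarterRoot k * quarterRoot k)
      = lift k * (starInvFc ϱ (lift k))⁻¹ :=
  (exists_fourth_root (lift k)).choose_spec.2.1

theorem commute_quarterRoot (k : PFc ϱ) {X : R →L[ℂ] R}
    (h : Commute (((lift k : (R →L[ℂ] R)ˣ) : R →L[ℂ] R)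
      * star ((lift k : (R →L[ℂ] R)ˣ) : R →L[ℂ] R)) X) :
    Commute ((quarterRoot k : (R →L[ℂ] R)ˣ) : R →L[ℂ] R) X :=
  (exists_fourth_root (lift k)).choose_spec.2.2 X h

/-- The inverse of the unitary factor in the polar decomposition of `k`. -/
def polarUnitary (k : PFc ϱ) : PFc ϱ :=
  (((lift k)⁻¹ * (quarterRoot k * quarterRoot k) : Fc ϱ) : PFc ϱ)

theorem polarUnitary_mem_PF (k : PFc ϱ) : polarUnitary k ∈ PF ϱ := by
  refine ⟨(lift k)⁻¹ * (quarterRoot k * quarterRoot k), ?_, rfl⟩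
  set w : Fc ϱ := (lift k)⁻¹ * (quarterRoot k * quarterRoot k) with hw
  -- With `f` the representative, `w w^* = f⁻¹ (f f^*) f^{*-1}`.
  have h : w * (starInvFc ϱ w)⁻¹ = 1 := by
    rw [hw, map_mul, map_mul, map_inv, mul_inv_rev, mul_inv_rev, inv_inv, star_quarterRoot]
    calc _ = (lift k)⁻¹ * (quarterRoot k * quarterRoot k * (quarterRoot k * quarterRoot k))
          * starInvFc ϱ (lift k) := by simp only [mul_assoc]
      _ = 1 := by rw [quarterRoot_pow_four]; group
  have h' : ((w : (R →L[ℂ] R)ˣ) : R →L[ℂ] R) * star ((w : (R →L[ℂ] R)ˣ) : R →L[ℂ] R) = 1 := by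
    rw [← starInvFc_inv_val]
    exact congrArg (fun a : Fc ϱ => ((a : (R →L[ℂ] R)ˣ) : R →L[ℂ] R)) h
  have h'' : star ((w : (R →L[ℂ] R)ˣ) : R →L[ℂ] R)
      = (((w : (R →L[ℂ] R)ˣ)⁻¹ : (R →L[ℂ] R)ˣ) : R →L[ℂ] R) :=
    Units.eq_inv_of_mul_eq_one_left h'
  change ((w : (R →L[ℂ] R)ˣ) : R →L[ℂ] R) ∈ unitary (R →L[ℂ] R)
  rw [Unitary.mem_iff]
  exact ⟨by rw [h'', Units.inv_mul], h'⟩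

end Polar

/-! ### Parallel polar decomposition and the unitary gauge transformation -/

section Uniqueness

open scoped Matrix.Norms.L2Operator
open Polynomial

variable {Γ : Subgroup SU2} {R : Type*} [NormedAddCommGroup R] [InnerProductSpace ℂ R]
  [CompleteSpace R] [FiniteDimensional ℂ R] {ϱ : Γ →* unitary (R →L[ℂ] R)}

/-- The covariant derivative form of `rigidity`. -/
theorem fderiv_gaugeMat [Fintype Γ] {c : ℝ} (hc : 0 < c) {ζ : R →L[ℂ] R} (hζ : ζ ∈ centre ϱ)
    {x₁ x₂ : Configuration ϱ} (mom₁ : x₁.MomentMap c ζ) (mom₂ : x₂.MomentMap c ζ)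
    {κ : ComplexGauge ϱ} (h : ComplexRelated κ x₁ x₂) {z : C2} (hz : z ≠ 0) (v : C2) :
    fderiv ℝ (gaugeMat ϱ κ.toFun) z v
      = gaugeMat ϱ κ.toFun z * hsRepL R (x₂.B z v) - hsRepL R (x₁.B z v) * gaugeMat ϱ κ.toFun z := by
  have hK := differentiableAt_of_punctured κ.contDiffOn_gaugeMat hz
  have h1 := (rigidity hc hζ mom₁ mom₂ h hz).1 v
  rw [delbar_star hK] at h1
  have h2 : del (gaugeMat ϱ κ.toFun) z v
      = gaugeMat ϱ κ.toFun z * x₂.B.mat10 v z - x₁.B.mat10 v z * gaugeMat ϱ κ.toFun z := by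
    rw [← star_star (del (gaugeMat ϱ κ.toFun) z v), h1, star_sub, star_mul, star_mul, star_star,
      x₁.star_mat01 hz, x₂.star_mat01 hz]
    noncomm_ring
  rw [← del_add_delbar, h2, delbar_gaugeMat_of_actForm κ x₁.isAdditive h.1 hz v,
    ← OneForm.mat10_add_mat01, ← OneForm.mat10_add_mat01]
  noncomm_ring

theorem fderiv_star_gaugeMat [Fintype Γ] {c : ℝ} (hc : 0 < c) {ζ : R →L[ℂ] R} (hζ : ζ ∈ centre ϱ)
    {x₁ x₂ : Configuration ϱ} (mom₁ : x₁.MomentMap c ζ) (mom₂ : x₂.MomentMap c ζ)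
    {κ : ComplexGauge ϱ} (h : ComplexRelated κ x₁ x₂) {z : C2} (hz : z ≠ 0) (v : C2) :
    fderiv ℝ (fun y => star (gaugeMat ϱ κ.toFun y)) z v
      = star (gaugeMat ϱ κ.toFun z) * hsRepL R (x₁.B z v)
        - hsRepL R (x₂.B z v) * star (gaugeMat ϱ κ.toFun z) := by
  rw [← del_add_delbar, (rigidity hc hζ mom₁ mom₂ h hz).1 v,
    del_star_gaugeMat_of_actForm κ x₁.isAdditive h.1 hz v,
    ← OneForm.mat10_add_mat01, ← OneForm.mat10_add_mat01]
  noncomm_ring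

theorem star_gaugeRep_mk (g : Fc ϱ) (h : (starInvFc ϱ g)⁻¹ = g) :
    star (gaugeRep ϱ (g : PFc ϱ)) = gaugeRep ϱ (g : PFc ϱ) := by
  rw [← gaugeRep_starInv_inv]
  have : (starInv ϱ (g : PFc ϱ))⁻¹ = (((starInvFc ϱ g)⁻¹ : Fc ϱ) : PFc ϱ) := rfl
  rw [this, h]

/-- The choice of representative is invisible here, since scalars act trivially on `End(R)`. -/
theorem gaugeRep_quarterRoot (k : PFc ϱ) :
    gaugeRep ϱ (quarterRoot k : PFc ϱ) * gaugeRep ϱ (quarterRoot k : PFc ϱ)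
      * (gaugeRep ϱ (quarterRoot k : PFc ϱ) * gaugeRep ϱ (quarterRoot k : PFc ϱ))
      = gaugeRep ϱ k * star (gaugeRep ϱ k) := by
  rw [← gaugeRep_starInv_inv, ← map_mul, ← map_mul, ← map_mul]
  congr 1
  have h := congrArg (fun a : Fc ϱ => (a : PFc ϱ)) (quarterRoot_pow_four k)
  have h2 : ((lift k * (starInvFc ϱ (lift k))⁻¹ : Fc ϱ) : PFc ϱ)
      = (lift k : PFc ϱ) * (starInv ϱ (lift k : PFc ϱ))⁻¹ := rfl
  rw [mk_lift] at h2
  exact h.trans h2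

/-- The positive part `(κ κ^*)^{1/2}` of a complex gauge transformation between two solutions is a
polynomial in `κ κ^*` with constant coefficients. -/
theorem exists_polynomial_positive_part [Fintype Γ] {c : ℝ} (hc : 0 < c) {ζ : R →L[ℂ] R}
    (hζ : ζ ∈ centre ϱ) {x₁ x₂ : Configuration ϱ} (mom₁ : x₁.MomentMap c ζ)
    (mom₂ : x₂.MomentMap c ζ) {κ : ComplexGauge ϱ} (h : ComplexRelated κ x₁ x₂) :
    ContDiffOn ℝ ∞
        (gaugeMat ϱ fun x => ((quarterRoot (κ.toFun x) * quarterRoot (κ.toFun x) : Fc ϱ) : PFc ϱ))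
        {0}ᶜ ∧
      ∀ z, z ≠ 0 → ∀ v, fderiv ℝ (gaugeMat ϱ fun x =>
          ((quarterRoot (κ.toFun x) * quarterRoot (κ.toFun x) : Fc ϱ) : PFc ϱ)) z v
        = gaugeMat ϱ (fun x =>
            ((quarterRoot (κ.toFun x) * quarterRoot (κ.toFun x) : Fc ϱ) : PFc ϱ)) z
            * hsRepL R (x₁.B z v)
          - hsRepL R (x₁.B z v) * gaugeMat ϱ (fun x =>
            ((quarterRoot (κ.toFun x) * quarterRoot (κ.toFun x) : Fc ϱ) : PFc ϱ)) z := by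
  set K := gaugeMat ϱ κ.toFun with hKdef
  set Q := gaugeMat ϱ fun x =>
    ((quarterRoot (κ.toFun x) * quarterRoot (κ.toFun x) : Fc ϱ) : PFc ϱ) with hQdef
  set H : C2 → HSMat R := fun y => K y * star (K y) with hHdef
  have hK : ContDiffOn ℝ ∞ K {0}ᶜ := κ.contDiffOn_gaugeMat
  have hT := contDiffOn_star hK
  have hH : ContDiffOn ℝ ∞ H {0}ᶜ := hK.mul hT
  have hstar : ∀ z, z ≠ 0 → star (H z) = H z := fun z _ => by
    simp only [hHdef, star_mul, star_star]
  have hd : ∀ z, z ≠ 0 → ∀ v, fderiv ℝ H z v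
      = H z * hsRepL R (x₁.B z v) - hsRepL R (x₁.B z v) * H z := by
    intro z hz v
    rw [hHdef, fderiv_mul_punctured (differentiableAt_of_punctured hK hz)
      (differentiableAt_of_punctured hT hz), fderiv_gaugeMat hc hζ mom₁ mom₂ h hz,
      fderiv_star_gaugeMat hc hζ mom₁ mom₂ h hz]
    noncomm_ring
  obtain ⟨z₀, hz₀⟩ := exists_ne (0 : C2)
  -- Because `H` is parallel, its minimal polynomial at one point annihilates it everywhere, so a
  -- single interpolating polynomial `q` works for all `z`.
  set m : ℝ[X] := minpoly ℝ (H z₀) with hm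
  have hint : IsIntegral ℝ (H z₀) := by
    have : FiniteDimensional ℝ (HSMat R) := FiniteDimensional.complexToReal _
    exact IsIntegral.of_finite ℝ _
  have hm0 : m ≠ 0 := minpoly.ne_zero hint
  have hmz : ∀ z, z ≠ 0 → aeval (H z) m = 0 := fun z hz =>
    aeval_eq_zero_of_covariantly_constant (traceL (Idx R × Idx R)) traceL_mul_comm
      (fun x hx => eq_zero_of_trace_star_mul_self_re (by
        rw [traceL_apply] at hx
        rw [hx, Complex.zero_re]))
      hH hstar hd hz₀ (minpoly.aeval ℝ _) hz
  set q : ℝ[X] := Lagrange.interpolate m.roots.toFinset id Real.sqrt with hq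
  have hqr : ∀ r, m.eval r = 0 → q.eval r = √r := fun r hr =>
    Lagrange.eval_interpolate_at_node (v := id) _ (Function.injective_id.injOn)
      (by simpa [hm0] using hr)
  -- The fourth roots are chosen point by point; this identity supplies the smoothness and the
  -- derivative of `Q`.
  have hQ : ∀ z, z ≠ 0 → Q z = aeval (H z) q := by
    intro z hz
    have hg := star_gaugeRep_mk _ (star_quarterRoot (κ.toFun (Projectivization.mk ℂ z hz)))
    have h4 := gaugeRep_quarterRoot (κ.toFun (Projectivization.mk ℂ z hz))
    rw [← gaugeMat_of_ne κ.toFun hz] at h4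
    have := aeval_eq_of_interpolates_sqrt hg h4 (hmz z hz) hqr
    rw [hQdef, gaugeMat_of_ne _ hz, QuotientGroup.mk_mul, map_mul]
    exact this.symm
  refine ⟨(contDiffOn_aeval hH q).congr fun z hz => hQ z hz, fun z hz v => ?_⟩
  have he : Q =ᶠ[nhds z] fun y => aeval (H y) q := by
    filter_upwards [isOpen_compl_singleton.mem_nhds hz] with y hy using hQ y hy
  rw [he.fderiv_eq, hQ z hz]
  exact (fderiv_aeval_of_commutator (differentiableAt_of_punctured hH hz) (hd z hz v) q).2

/-- The unitary gauge transformation defined by the polar decomposition of a complex gauge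
transformation between two solutions. -/
theorem exists_unitaryRelated [Fintype Γ] {c : ℝ} (hc : 0 < c) {ζ : R →L[ℂ] R}
    (hζ : ζ ∈ centre ϱ) {x₁ x₂ : Configuration ϱ} (mom₁ : x₁.MomentMap c ζ)
    (mom₂ : x₂.MomentMap c ζ) {κ : ComplexGauge ϱ} (h : ComplexRelated κ x₁ x₂) :
    ∃ ρ : ComplexGauge ϱ, UnitaryRelated ρ x₁ x₂ := by
  obtain ⟨hQs, hQd⟩ := exists_polynomial_positive_part hc hζ mom₁ mom₂ h
  set P : CP1 → PFc ϱ := fun x =>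
    ((quarterRoot (κ.toFun x) * quarterRoot (κ.toFun x) : Fc ϱ) : PFc ϱ) with hP
  have hρ : ∀ x, polarUnitary (κ.toFun x) = (κ.toFun x)⁻¹ * P x := fun x => by
    have : polarUnitary (κ.toFun x) = ((lift (κ.toFun x) : Fc ϱ) : PFc ϱ)⁻¹ * P x := rfl
    rw [this, mk_lift]
  have hmul : ∀ z, z ≠ 0 → gaugeMat ϱ (fun x => polarUnitary (κ.toFun x)) z
      = gaugeMat ϱ (fun x => (κ.toFun x)⁻¹) z * gaugeMat ϱ P z := fun z hz => by
    rw [gaugeMat_of_ne _ hz, gaugeMat_of_ne _ hz, gaugeMat_of_ne _ hz, hρ, map_mul]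
  have hKs := κ.contDiffOn_gaugeMat
  have hWs : ContDiffOn ℝ ∞ (gaugeMat ϱ fun x => polarUnitary (κ.toFun x)) {0}ᶜ :=
    ((contDiffOn_gaugeMat_inv hKs).mul hQs).congr hmul
  have hYs := contDiffOn_gaugeMat_inv hWs
  refine ⟨⟨fun x => polarUnitary (κ.toFun x), fun γ z hz => by rw [κ.invariant γ z hz],
    (contDiffOn_pullback_iff _).2 hWs⟩, fun x => polarUnitary_mem_PF _, fun z hz v => ?_,
    fun z hz => ?_⟩
  · have hfac : ∀ y, y ≠ 0 → gaugeMat ϱ κ.toFun y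
        = gaugeMat ϱ P y * gaugeMat ϱ (fun x => (polarUnitary (κ.toFun x))⁻¹) y := fun y hy => by
      rw [gaugeMat_of_ne _ hy, gaugeMat_of_ne _ hy, gaugeMat_of_ne _ hy, ← map_mul, hρ]
      congr 1
      group
    have he : gaugeMat ϱ κ.toFun =ᶠ[nhds z] fun y =>
        gaugeMat ϱ P y * gaugeMat ϱ (fun x => (polarUnitary (κ.toFun x))⁻¹) y := by
      filter_upwards [isOpen_compl_singleton.mem_nhds hz] with y hy using hfac y hy
    have hdK := fderiv_gaugeMat hc hζ mom₁ mom₂ h hz v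
    rw [he.fderiv_eq, fderiv_mul_punctured (differentiableAt_of_punctured hQs hz)
      (differentiableAt_of_punctured hYs hz), hQd z hz v, hfac z hz] at hdK
    apply (hsRep R).injective
    change hsRepL R _ = hsRepL R _
    rw [map_add, hsRepL_mul, map_sub, map_add, hsRepL_mul, hsRepL_mul,
      hsRepL_fderiv_pullback hYs hz]
    change _ = _ + gaugeMat ϱ (fun x => polarUnitary (κ.toFun x)) z
      * (fderiv ℝ (gaugeMat ϱ fun x => (polarUnitary (κ.toFun x))⁻¹) z v
        + _ * gaugeMat ϱ (fun x => (polarUnitary (κ.toFun x))⁻¹) z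
        - gaugeMat ϱ (fun x => (polarUnitary (κ.toFun x))⁻¹) z * _)
    have hPi := gaugeMat_inv_mul (ϱ := ϱ) P hz
    have hWY := gaugeMat_mul_inv (ϱ := ϱ) (fun x => polarUnitary (κ.toFun x)) hz
    set p := gaugeMat ϱ P z
    set p' := gaugeMat ϱ (fun x => (P x)⁻¹) z
    set w := gaugeMat ϱ (fun x => polarUnitary (κ.toFun x)) z
    set y := gaugeMat ϱ (fun x => (polarUnitary (κ.toFun x))⁻¹) z
    set dy := fderiv ℝ (gaugeMat ϱ fun x => (polarUnitary (κ.toFun x))⁻¹) z v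
    set b₁ := hsRepL R (x₁.B z v)
    set b₂ := hsRepL R (x₂.B z v)
    -- Write `κ = P ρ⁻¹` and apply the product rule: the covariant derivatives of `κ` and of `P`
    -- vanish, so that of `ρ⁻¹` vanishes after cancelling `P`. This is the transformation law for
    -- `B₂`.
    have e1 : p * (dy + b₁ * y) = p * (y * b₂) := by
      have : p * (dy + b₁ * y) = (p * b₁ - b₁ * p) * y + p * dy + b₁ * (p * y) := by noncomm_ring
      rw [this, hdK]
      noncomm_ring
    have e2 : dy + b₁ * y = y * b₂ := by
      have := congrArg (fun a => p' * a) e1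
      simpa only [← mul_assoc, hPi, one_mul] using this
    rw [e2, mul_sub, ← mul_assoc, ← mul_assoc, hWY, one_mul, one_mul]
    abel
  · have hf := (rigidity hc hζ mom₁ mom₂ h hz).2 _ (mk_lift _)
    have h2 := h.2 z hz
    set k := κ.toFun (Projectivization.mk ℂ z hz) with hk
    set A := x₁.Θ.toFun (toS3 z hz)
    set B := x₂.Θ.toFun (toS3 z hz)
    have h3 : A = Ad ϱ ((lift k : Fc ϱ) : PFc ϱ) B := by rw [mk_lift]; exact h2
    set F : R →L[ℂ] R := ((lift k : (R →L[ℂ] R)ˣ) : R →L[ℂ] R) with hF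
    have h4 : A = F * B * (((lift k : (R →L[ℂ] R)ˣ)⁻¹ : (R →L[ℂ] R)ˣ) : R →L[ℂ] R) := h3
    have h5 : A * F = F * B := by rw [h4, mul_assoc, hF, Units.inv_mul, mul_one]
    -- `F F^* A = F B F^* = A F F^*`. The fourth root of `F F^*` then also commutes with `A`, so the
    -- positive part fixes `A` and `ρ` acts on it as `κ⁻¹`.
    have hcomm : Commute (F * star F) A := by
      change F * star F * A = A * (F * star F)
      rw [mul_assoc, hf, ← mul_assoc, ← h5, mul_assoc]
    have hg := commute_quarterRoot k hcomm
    set G : (R →L[ℂ] R)ˣ := (quarterRoot k : (R →L[ℂ] R)ˣ) with hG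
    have hgg : Ad ϱ ((quarterRoot k : Fc ϱ) : PFc ϱ) A = A := by
      change (G : R →L[ℂ] R) * A * ((G⁻¹ : (R →L[ℂ] R)ˣ) : R →L[ℂ] R) = A
      rw [hg.eq, mul_assoc, Units.mul_inv, mul_one]
    change B = Ad ϱ (polarUnitary k) A
    have h6 : polarUnitary k = k⁻¹ * (((quarterRoot k : Fc ϱ) : PFc ϱ)
        * ((quarterRoot k : Fc ϱ) : PFc ϱ)) := hρ _
    have h7 : ∀ (a b : PFc ϱ) (X : R →L[ℂ] R), Ad ϱ (a * b) X = Ad ϱ a (Ad ϱ b X) :=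
      fun a b X => by rw [map_mul]; rfl
    rw [h6, h7, h7, hgg, hgg, h2, ← h7, inv_mul_cancel, map_one]
    rfl

end Uniqueness

end ALEGauge

end

theorem lemma5p6 (Γ : Subgroup SU2) [Fintype Γ]
    {R : Type*} [NormedAddCommGroup R] [InnerProductSpace ℂ R] [FiniteDimensional ℂ R]
    [CompleteSpace R] (ϱ : Γ →* unitary (R →L[ℂ] R)) (hϱ : IsRegular ϱ)
    (c : ℝ) (hc : 0 < c) (ζ : R →L[ℂ] R) (hζ : ζ ∈ centre ϱ)
    (x₁ x₂ : Configuration ϱ)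
    (hol₁ : x₁.Holomorphic) (hol₂ : x₂.Holomorphic)
    (mom₁ : x₁.MomentMap c ζ) (mom₂ : x₂.MomentMap c ζ)
    (horbit : ∃ κ : ComplexGauge ϱ, ComplexRelated κ x₁ x₂) :
    ∃ ρ : ComplexGauge ϱ, UnitaryRelated ρ x₁ x₂ := by
  obtain ⟨κ, hκ⟩ := horbit
  exact exists_unitaryRelated hc hζ mom₁ mom₂ hκ
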